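/- For a positive integer $n$ and a complex number $q$ with $|q|<1$ let $E_n=(q^n;q^n)_\infty=\prod_{k\ge 1}(1-q^{nk})$. For integers $t\ge 1$ and $n\ge 0$ let $a_t(n)$ be the number of partitions $\lambda$ of $n$ that are $t$-cores, that is, such that no hook number $\lambda_i+\lambda'_j-i-j+1$ of a node $(i,j)$ of the Ferrers–Young diagram of $\lambda$ is a multiple of $t$ (here $\lambda_i$ and $\lambda'_j$ are the numbers of nodes in row $i$ and in column $j$; the empty partition is counted, so $a_t(0)=1$). Then, for $|q|<1$, \begin{align*} \sum_{n=0}^{\infty}a_{4}(5n)q^{n}&=\dfrac{E_4^4E_{10}^{40}}{E_1^2E_2^8E_5^{15}E_{20}^{16}}-q\left(3\dfrac{E_4^2E_{10}^{15}}{E_1^5E_2^3E_{20}^{6}}-4\dfrac{E_4^3E_{10}^{30}}{E_1^3E_2^6E_5^{10}E_{20}^{11}}\right)\\ &\quad-q^2\left(12\dfrac{E_4^2E_{10}^{20}}{E_1^4E_2^4E_5^{5}E_{20}^{6}}+20\dfrac{E_4E_5^{5}E_{10}^{5}}{E_1^6E_2E_{20}}-24\dfrac{E_4^3E_{10}^{35}}{E_1^2E_2^7E_5^{15}E_{20}^{11}}\right)\\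 &\quad-q^3\left(27\dfrac{E_2E_5^{10}E_{20}^{4}}{E_1^7E_{10}^5}+60\dfrac{E_4E_{10}^{10}}{E_1^5E_2^2E_{20}}-196\dfrac{E_4^2E_{10}^{25}}{E_1^3E_2^5E_5^{10}E_{20}^{6}}\right)\\ &\quad-q^4\left(83\dfrac{E_5^{5}E_{20}^{4}}{E_1^6}-456\dfrac{E_4E_{10}^{15}}{E_1^4E_2^3E_5^{5}E_{20}}\right)+q^5\left(296\dfrac{E_{10}^{5}E_{20}^{4}}{E_1^5E_2}+96\dfrac{E_4E_{10}^{20}}{E_1^3E_2^4E_5^{10}E_{20}}\right)\\ &\quad+q^6\left(128\dfrac{E_2E_5^{5}E_{20}^{9}}{E_1^6E_4E_{10}^{5}}+592\dfrac{E_{10}^{10}E_{20}^{4}}{E_1^4E_2^2E_5^{5}}\right)+512q^7\dfrac{E_{20}^{9}}{E_1^5E_4}, \end{align*} where the series on the left converges. -/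

import Mathlib

/-- The Ferrers–Young diagram of a partition: its `i`-th row has `λ_i` nodes, where
`λ_0 ≥ λ_1 ≥ …` are the parts of the partition in non-increasing order. -/
def partitionDiagram {n : ℕ} (p : n.Partition) : YoungDiagram :=
  YoungDiagram.ofRowLens (p.parts.sort (· ≥ ·)) (Multiset.pairwise_sort p.parts (· ≥ ·)).sortedGE

/-- The hook number of the node in row `i` and column `j`. Rows and columns are counted from `0`
here; for `1`-based `i` and `j` the same number reads `λ_i + λ'_j - i - j + 1`. -/
def hookNumber (μ : YoungDiagram) (i j : ℕ) : ℤ :=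
  (μ.rowLen i : ℤ) + (μ.colLen j : ℤ) - (i : ℤ) - (j : ℤ) - 1

/-- A partition is a `t`-core if none of the hook numbers of the nodes of its Ferrers–Young
diagram is a multiple of `t`. -/
def IsCorePartition (t : ℕ) {n : ℕ} (p : n.Partition) : Prop :=
  ∀ c ∈ (partitionDiagram p).cells, ¬ (t : ℤ) ∣ hookNumber (partitionDiagram p) c.1 c.2

/-- `a_t(n)`, the number of partitions of `n` that are `t`-cores. -/
noncomputable def coreCount (t n : ℕ) : ℕ :=
  Nat.card {p : n.Partition // IsCorePartition t p}

/-- The `q`-product `(a; q)_∞ = ∏_{k ≥ 0} (1 - a q^k)`, used for `|q| < 1`. -/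
noncomputable def qProduct (a q : ℂ) : ℂ := ∏' k : ℕ, (1 - a * q ^ k)

/-- `E_n = (q^n; q^n)_∞`, as a function of `q`. -/
noncomputable def eulerE (n : ℕ) (q : ℂ) : ℂ := qProduct (q ^ n) (q ^ n)

/-!
Move the `i`-th row of a Young diagram to the bead `i - λ_i` on the integer line. The hook numbers
are the distances from beads up to gaps, so a diagram is a `t`-core exactly when its bead set is
closed under adding `t`. Such a set is determined by the least bead of each residue class modulo
`t`, hence by an integer vector whose sum has to vanish, and the size of the diagram is a quadratic
function of the vector. If the condition on the sum is dropped, the generating function becomes a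
product of theta series, and translating the beads shows that it has to be divided by
`∑ q^{n(n-1)/2}`: by the Jacobi triple product, `∑ a_t(n) q^n = E_t^t / E_1`.

For `t = 4` this is `ψ(q) ψ(q²)²` with `ψ(q) = ∑_{n ≥ 0} q^{n(n+1)/2}`. Splitting `ψ` modulo `5` and
keeping the exponents divisible by `5` leaves a sum of three quotients of Euler products, once
Schröter's formula has been applied to the products of theta series that occur. Dividing by the
first of the sixteen terms turns both sides into rational functions of `x = h(q)` and `y = h(q²)`,
where `h = E_2 E_5^5 / (q E_1 E_10^5)`. They agree on the curve
`y² + 2xy - x²y + 4x = 0`, which is the modular equation of degree two for `h`.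
-/

section QProduct

open Filter Topology

variable {a q : ℂ}

lemma summable_norm_mul_pow (a : ℂ) (hq : ‖q‖ < 1) : Summable fun k : ℕ => ‖-(a * q ^ k)‖ := by
  simpa [norm_mul, norm_pow] using
    (summable_geometric_of_lt_one (norm_nonneg q) hq).mul_left ‖a‖

lemma multipliable_one_sub_mul_pow (a : ℂ) (hq : ‖q‖ < 1) :
    Multipliable fun k : ℕ => 1 - a * q ^ k := by
  simpa [sub_eq_add_neg] using multipliable_one_add_of_summable (summable_norm_mul_pow a hq)

lemma tendsto_qProduct (a : ℂ) (hq : ‖q‖ < 1) :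
    Tendsto (fun n => ∏ k ∈ Finset.range n, (1 - a * q ^ k)) atTop (𝓝 (qProduct a q)) :=
  (multipliable_one_sub_mul_pow a hq).hasProd.tendsto_prod_nat

lemma qProduct_ne_zero (hq : ‖q‖ < 1) (h : ∀ k : ℕ, a * q ^ k ≠ 1) : qProduct a q ≠ 0 := by
  have := tprod_one_add_ne_zero_of_summable (f := fun k : ℕ => -(a * q ^ k))
    (fun k => by simpa [← sub_eq_add_neg, sub_ne_zero] using (h k).symm)
    (summable_norm_mul_pow a hq)
  simpa [qProduct, sub_eq_add_neg] using this

lemma qProduct_ne_zero_of_norm_lt_one (ha : ‖a‖ < 1) (hq : ‖q‖ < 1) : qProduct a q ≠ 0 := by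
  refine qProduct_ne_zero hq fun k h => ?_
  have h1 : ‖a * q ^ k‖ < 1 := by
    rw [norm_mul, norm_pow]
    exact (mul_le_of_le_one_right (norm_nonneg a) (pow_le_one₀ (norm_nonneg q) hq.le)).trans_lt ha
  rw [h] at h1
  exact h1.ne norm_one

lemma norm_pow_lt_one (hq : ‖q‖ < 1) {n : ℕ} (hn : n ≠ 0) : ‖q ^ n‖ < 1 := by
  rw [norm_pow]
  exact pow_lt_one₀ (norm_nonneg q) hq hn

lemma qProduct_eq_prod (a : ℂ) (hq : ‖q‖ < 1) (m : ℕ) [NeZero m] :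
    qProduct a q = ∏ i : Fin m, qProduct (a * q ^ (i : ℕ)) (q ^ m) := by
  have hfin : ∀ n : ℕ, ∏ k ∈ Finset.range (n * m), (1 - a * q ^ k) =
      ∏ i : Fin m, ∏ k ∈ Finset.range n, (1 - a * q ^ (i : ℕ) * (q ^ m) ^ k) := by
    intro n
    induction n with
    | zero => simp
    | succ n ih =>
      rw [add_one_mul, Finset.prod_range_add, ih,
        Finset.prod_range fun x => 1 - a * q ^ (n * m + x), ← Finset.prod_mul_distrib]
      refine Finset.prod_congr rfl fun i _ => ?_
      rw [Finset.prod_range_succ, pow_add, mul_comm n m, pow_mul]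
      ring
  have h1 := (tendsto_qProduct a hq).comp
    (tendsto_id.atTop_mul_const' (Nat.pos_of_ne_zero (NeZero.ne m)))
  refine tendsto_nhds_unique (h1.congr hfin) (tendsto_finsetProd _ fun i _ => ?_)
  exact tendsto_qProduct _ (norm_pow_lt_one hq (NeZero.ne m))

lemma qProduct_mul_qProduct_neg (a : ℂ) (hq : ‖q‖ < 1) :
    qProduct a q * qProduct (-a) q = qProduct (a ^ 2) (q ^ 2) := by
  rw [qProduct, qProduct, ← (multipliable_one_sub_mul_pow a hq).tprod_mul
    (multipliable_one_sub_mul_pow (-a) hq), qProduct]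
  exact tprod_congr fun k => by ring

lemma qProduct_eq_one_sub_mul (a : ℂ) (hq : ‖q‖ < 1) :
    qProduct a q = (1 - a) * qProduct (a * q) q := by
  have h1 := (tendsto_qProduct a hq).comp (tendsto_add_atTop_nat 1)
  have h2 := (tendsto_qProduct (a * q) hq).const_mul (1 - a)
  refine tendsto_nhds_unique h1 (h2.congr fun n => ?_)
  rw [Function.comp_apply, Finset.prod_range_succ', mul_comm]
  simp [pow_succ', mul_assoc]

end QProduct

section TripleProduct

open Filter Topology

variable {q z : ℂ}

lemma qProduct_zpow (hq0 : q ≠ 0) (hq : ‖q‖ < 1) (n : ℤ) :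
    qProduct (q ^ n) q = (1 - q ^ n) * qProduct (q ^ (n + 1)) q := by
  rw [qProduct_eq_one_sub_mul _ hq, zpow_add_one₀ hq0]

lemma qProduct_zpow_of_nonpos (hq0 : q ≠ 0) (hq : ‖q‖ < 1) {n : ℤ} (hn : n ≤ 0) :
    qProduct (q ^ n) q = 0 := by
  induction n, hn using Int.leInductionDown with
  | base => rw [qProduct_zpow hq0 hq, zpow_zero, sub_self, zero_mul]
  | pred n _ ih => rw [qProduct_zpow hq0 hq, sub_add_cancel, ih, mul_zero]

lemma prod_mul_qProduct_pow (hq : ‖q‖ < 1) (n : ℕ) :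
    (∏ k ∈ Finset.range n, (1 - q * q ^ k)) * qProduct (q ^ (n + 1)) q = qProduct q q := by
  induction n with
  | zero => simp
  | succ n ih =>
    rw [← ih, Finset.prod_range_succ, qProduct_eq_one_sub_mul (q ^ (n + 1)) hq, mul_assoc,
      ← pow_succ, ← pow_succ']

lemma tendsto_qProduct_pow (hq : ‖q‖ < 1) :
    Tendsto (fun n : ℕ => qProduct (q ^ (n + 1)) q) atTop (𝓝 1) := by
  have hE : qProduct q q ≠ 0 := qProduct_ne_zero_of_norm_lt_one hq hq
  rw [← div_self hE]
  refine (tendsto_const_nhds.div (tendsto_qProduct q hq) hE).congr fun n => ?_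
  have hn := prod_mul_qProduct_pow hq n
  rw [Pi.div_apply, div_eq_iff (left_ne_zero_of_mul (hn ▸ hE)), mul_comm, hn]

lemma tendsto_qProduct_zpow (hq : ‖q‖ < 1) :
    Tendsto (fun n : ℤ => qProduct (q ^ n) q) atTop (𝓝 1) := by
  have hsub : Tendsto (fun n : ℤ => (n - 1).toNat) atTop atTop :=
    tendsto_atTop_atTop.mpr fun b => ⟨b + 1, fun n hn => by omega⟩
  refine ((tendsto_qProduct_pow hq).comp hsub).congr' ?_
  filter_upwards [eventually_ge_atTop 1] with n hn
  rw [Function.comp_apply, ← zpow_natCast]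
  congr 2
  omega

lemma exists_norm_qProduct_zpow_le (hq0 : q ≠ 0) (hq : ‖q‖ < 1) :
    ∃ C : ℝ, ∀ n : ℤ, ‖qProduct (q ^ n) q‖ ≤ C := by
  obtain ⟨C, hC⟩ := (tendsto_qProduct_pow hq).norm.bddAbove_range
  refine ⟨C, fun n => ?_⟩
  rcases le_or_gt n 0 with hn | hn
  · rw [qProduct_zpow_of_nonpos hq0 hq hn, norm_zero]
    exact (norm_nonneg _).trans (hC ⟨0, rfl⟩)
  · obtain ⟨k, rfl⟩ := Int.eq_succ_of_zero_lt hn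
    exact hC ⟨k, by norm_cast⟩

/-- The generalized triangular number `n (n - 1) / 2`. -/
def tri (n : ℤ) : ℤ := n * (n - 1) / 2

lemma two_mul_tri (n : ℤ) : 2 * tri n = n * (n - 1) :=
  Int.mul_ediv_cancel' (Int.even_mul_pred_self n).two_dvd

lemma tri_add (m n : ℤ) : tri (m + n) = tri m + tri n + m * n := by
  linarith [two_mul_tri m, two_mul_tri n, two_mul_tri (m + n)]

lemma tri_mul (m n : ℤ) : tri (m * n) = m ^ 2 * tri n + tri m * n := by
  linarith [two_mul_tri (m * n), congrArg (m ^ 2 * ·) (two_mul_tri n),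
    congrArg (· * n) (two_mul_tri m)]

lemma tri_neg (n : ℤ) : tri (-n) = tri n + n := by
  linarith [two_mul_tri n, two_mul_tri (-n)]

lemma tri_natCast (n : ℕ) : tri n = n.choose 2 := by
  induction n with
  | zero => rfl
  | succ n ih =>
    rw [Nat.cast_succ, tri_add, ih, Nat.choose_succ_succ', Nat.choose_one_right]
    push_cast
    rw [show tri 1 = 0 from rfl]
    ring

/-- The two-variable theta series `∑ q^{n(n-1)/2} z^n`, which is Ramanujan's `f(z, q / z)`.
All theta functions of the development are specializations of it. -/
noncomputable def theta (q z : ℂ) : ℂ := ∑' n : ℤ, q ^ tri n * z ^ n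

lemma summable_theta_nat (hq0 : q ≠ 0) (hq : ‖q‖ < 1) (hz : z ≠ 0) :
    Summable fun n : ℕ => q ^ tri n * z ^ (n : ℤ) := by
  refine summable_of_ratio_test_tendsto_lt_one (l := 0) one_pos
    (.of_forall fun n => mul_ne_zero (zpow_ne_zero _ hq0) (zpow_ne_zero _ hz)) ?_
  have h : Tendsto (fun n : ℕ => ‖q ^ n * z‖) atTop (𝓝 ‖0 * z‖) :=
    ((tendsto_pow_atTop_nhds_zero_of_norm_lt_one hq).mul_const z).norm
  rw [zero_mul, norm_zero] at h
  refine h.congr fun n => ?_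
  rw [← norm_div, Nat.cast_add_one, tri_add, mul_one, show tri 1 = 0 from rfl, add_zero,
    zpow_add₀ hq0, zpow_add_one₀ hz, zpow_natCast, zpow_natCast]
  congr 1
  have := zpow_ne_zero (tri n) hq0
  have := pow_ne_zero n hz
  field_simp

lemma hasSum_theta (hq0 : q ≠ 0) (hq : ‖q‖ < 1) (hz : z ≠ 0) :
    HasSum (fun n : ℤ => q ^ tri n * z ^ n) (theta q z) := by
  have h : Summable fun n : ℤ => q ^ tri n * z ^ n := by
    refine .of_nat_of_neg (summable_theta_nat hq0 hq hz) ?_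
    refine (summable_theta_nat hq0 hq (mul_ne_zero hq0 (inv_ne_zero hz))).congr fun n => ?_
    rw [tri_neg, zpow_add₀ hq0, mul_zpow, zpow_neg, inv_zpow, mul_assoc]
  exact h.hasSum

lemma one_sub_pow_ne_zero (hq : ‖q‖ < 1) (n : ℕ) [NeZero n] : 1 - q ^ n ≠ 0 := by
  rw [sub_ne_zero]
  exact fun h => (norm_pow_lt_one hq (NeZero.ne n)).ne (h ▸ norm_one)

lemma qProduct_zpow_mul_recurrence (hq0 : q ≠ 0) (hq : ‖q‖ < 1) (N : ℕ) (n : ℤ) :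
    (1 - q ^ (2 * N + 1)) * (1 - q ^ (2 * N + 2)) *
        (qProduct (q ^ (N + 1 + 1 - n)) q * qProduct (q ^ (N + 1 + 1 + n)) q) =
      (1 + q ^ (2 * N + 1)) * (qProduct (q ^ (N + 1 - n)) q * qProduct (q ^ (N + 1 + n)) q) +
        q ^ (N + 1 - n) *
          (qProduct (q ^ (N + 1 - (n - 1))) q * qProduct (q ^ (N + 1 + (n - 1))) q) +
        q ^ (N + 1 + n) *
          (qProduct (q ^ (N + 1 - (n + 1))) q * qProduct (q ^ (N + 1 + (n + 1))) q) := by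
  obtain ⟨a, ha⟩ : ∃ a : ℤ, a = N + 1 - n := ⟨_, rfl⟩
  obtain ⟨b, hb⟩ : ∃ b : ℤ, b = N + 1 + n := ⟨_, rfl⟩
  have hab : q ^ a * q ^ b = q ^ (2 * N + 2) := by
    rw [← zpow_add₀ hq0, ← zpow_natCast]
    congr 1
    push_cast
    omega
  have hab' : q ^ (2 * N + 1) = q ^ a * q ^ b * q⁻¹ := by
    rw [hab, pow_succ _ (2 * N + 1), mul_inv_cancel_right₀ hq0]
  rw [show (N + 1 + 1 - n : ℤ) = a + 1 by omega, show (N + 1 + 1 + n : ℤ) = b + 1 by omega,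
    show (N + 1 - (n - 1) : ℤ) = a + 1 by omega, show (N + 1 + (n - 1) : ℤ) = b - 1 by omega,
    show (N + 1 - (n + 1) : ℤ) = a - 1 by omega, show (N + 1 + (n + 1) : ℤ) = b + 1 by omega,
    ← ha, ← hb, hab', ← hab, qProduct_zpow hq0 hq (a - 1), qProduct_zpow hq0 hq (b - 1),
    sub_add_cancel, sub_add_cancel, qProduct_zpow hq0 hq a, qProduct_zpow hq0 hq b,
    zpow_sub_one₀ hq0, zpow_sub_one₀ hq0]
  ring

lemma hasSum_finite_tripleProduct_zero (hq0 : q ≠ 0) (hq : ‖q‖ < 1) (z : ℂ) :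
    HasSum (fun n : ℤ => qProduct (q ^ (1 - n)) q * qProduct (q ^ (1 + n)) q *
        (q ^ tri n * z ^ n)) (qProduct q q ^ 2) := by
  have h : ∀ n : ℤ, n ≠ 0 → qProduct (q ^ (1 - n)) q * qProduct (q ^ (1 + n)) q *
      (q ^ tri n * z ^ n) = 0 := by
    intro n hn
    rcases lt_or_gt_of_ne hn with hn | hn
    · rw [qProduct_zpow_of_nonpos hq0 hq (n := 1 + n) (by omega), mul_zero, zero_mul]
    · rw [qProduct_zpow_of_nonpos hq0 hq (n := 1 - n) (by omega), zero_mul, zero_mul]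
  convert! hasSum_single 0 h using 1
  simp [show tri 0 = 0 from rfl, sq]

-- Both sides satisfy the same first-order recurrence in `N`.
lemma hasSum_finite_tripleProduct (hq0 : q ≠ 0) (hq : ‖q‖ < 1) (hz : z ≠ 0) (N : ℕ) :
    HasSum (fun n : ℤ => qProduct (q ^ (N + 1 - n)) q * qProduct (q ^ (N + 1 + n)) q *
        (q ^ tri n * z ^ n))
      (qProduct (q ^ (2 * N + 1)) q * qProduct q q *
        ((∏ k ∈ Finset.range N, (1 - -z * q ^ k)) *
          ∏ k ∈ Finset.range N, (1 - -(q / z) * q ^ k))) := by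
  induction N with
  | zero => simpa [sq] using hasSum_finite_tripleProduct_zero hq0 hq z
  | succ N ih =>
    have hD : (1 - q ^ (2 * N + 1)) * (1 - q ^ (2 * N + 2)) ≠ 0 :=
      mul_ne_zero (one_sub_pow_ne_zero hq _) (one_sub_pow_ne_zero hq _)
    rw [← hasSum_mul_left_iff hD]
    have hpred := ((Equiv.subRight (1 : ℤ)).hasSum_iff.mpr ih).mul_left (q ^ N * z)
    have hsucc := ((Equiv.addRight (1 : ℤ)).hasSum_iff.mpr ih).mul_left (q ^ N * (q / z))
    convert! (ih.mul_left (1 + q ^ (2 * N + 1))).add (hpred.add hsucc) using 1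
    · funext n
      simp only [Function.comp_apply, Equiv.subRight_apply, Equiv.coe_addRight, Nat.cast_succ]
      have htri : tri n = tri (n - 1) + (n - 1) := by
        linarith [two_mul_tri n, two_mul_tri (n - 1)]
      have hpow : q ^ (N + 1 - n) * (q ^ tri n * z ^ n) =
          q ^ N * z * (q ^ tri (n - 1) * z ^ (n - 1)) := by
        rw [htri, ← zpow_natCast, zpow_sub_one₀ hz, ← mul_assoc, ← zpow_add₀ hq0,
          show (N + 1 - n + (tri (n - 1) + (n - 1)) : ℤ) = N + tri (n - 1) by ring,
          zpow_add₀ hq0]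
        field_simp
      have hpow' : q ^ (N + 1 + n) * (q ^ tri n * z ^ n) =
          q ^ N * (q / z) * (q ^ tri (n + 1) * z ^ (n + 1)) := by
        rw [tri_add, mul_one, show tri 1 = 0 from rfl, add_zero, zpow_add_one₀ hz,
          zpow_add₀ hq0 (tri n), zpow_add₀ hq0 (N + 1), zpow_add_one₀ hq0, zpow_natCast]
        field_simp
      linear_combination (q ^ tri n * z ^ n) * qProduct_zpow_mul_recurrence hq0 hq N n +
        qProduct (q ^ (N + 1 - (n - 1))) q * qProduct (q ^ (N + 1 + (n - 1))) q * hpow +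
        qProduct (q ^ (N + 1 - (n + 1))) q * qProduct (q ^ (N + 1 + (n + 1))) q * hpow'
    · have hT : qProduct (q ^ (2 * N + 1)) q = (1 - q ^ (2 * N + 1)) *
          ((1 - q ^ (2 * N + 2)) * qProduct (q ^ (2 * (N + 1) + 1)) q) := by
        rw [qProduct_eq_one_sub_mul _ hq, ← pow_succ, qProduct_eq_one_sub_mul _ hq, ← pow_succ]
        rfl
      rw [Finset.prod_range_succ, Finset.prod_range_succ, hT]
      field_simp
      ring

theorem theta_eq_qProduct (hq0 : q ≠ 0) (hq : ‖q‖ < 1) (hz : z ≠ 0) :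
    theta q z = qProduct q q * qProduct (-z) q * qProduct (-(q / z)) q := by
  obtain ⟨C, hC⟩ := exists_norm_qProduct_zpow_le hq0 hq
  have hC0 : 0 ≤ C := (norm_nonneg _).trans (hC 0)
  have hcast : Tendsto (fun N : ℕ => (N : ℤ) + 1) atTop atTop :=
    tendsto_atTop_add_const_right _ 1 tendsto_natCast_atTop_atTop
  have hcoeff : ∀ n : ℤ, Tendsto (fun N : ℕ => qProduct (q ^ (N + 1 - n)) q *
      qProduct (q ^ (N + 1 + n)) q * (q ^ tri n * z ^ n)) atTop (𝓝 (q ^ tri n * z ^ n)) := by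
    intro n
    have hsub := (tendsto_qProduct_zpow hq).comp (tendsto_atTop_add_const_right _ (-n) hcast)
    have hadd := (tendsto_qProduct_zpow hq).comp (tendsto_atTop_add_const_right _ n hcast)
    simpa using! (hsub.mul hadd).mul_const (q ^ tri n * z ^ n)
  have hleft := tendsto_tsum_of_dominated_convergence
    ((hasSum_theta hq0 hq hz).summable.norm.mul_left (C * C)) hcoeff
    (.of_forall fun N n => by
      rw [norm_mul, norm_mul]
      gcongr
      exacts [hC _, hC _])
  have htwo : Tendsto (fun N => 2 * N) atTop atTop :=
    tendsto_id.const_mul_atTop' (zero_lt_two' ℕ)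
  have hright := (((tendsto_qProduct_pow hq).comp htwo).mul_const (qProduct q q)).mul
    ((tendsto_qProduct (-z) hq).mul (tendsto_qProduct (-(q / z)) hq))
  rw [one_mul, ← mul_assoc] at hright
  exact tendsto_nhds_unique
    (hleft.congr fun N => (hasSum_finite_tripleProduct hq0 hq hz N).tsum_eq) hright

end TripleProduct

lemma hasSum_prod_mul {ι κ : Type*} {f : ι → ℂ} {g : κ → ℂ} {S T : ℂ} (hf : HasSum f S)
    (hg : HasSum g T) : HasSum (fun p : ι × κ => f p.1 * g p.2) (S * T) :=
  hf.mul hg (summable_mul_of_summable_norm hf.summable.norm hg.summable.norm)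

section Theta

variable {q z w : ℂ}

lemma theta_div (hq0 : q ≠ 0) (z : ℂ) : theta q (q / z) = theta q z := by
  rw [theta, theta]
  rw [← (Equiv.neg ℤ).tsum_eq]
  refine tsum_congr fun n => ?_
  rw [Equiv.neg_apply, tri_neg, zpow_add₀ hq0, zpow_neg, div_zpow, inv_div, mul_assoc,
    mul_div_cancel₀ _ (zpow_ne_zero n hq0)]

lemma theta_eq_mul (hq0 : q ≠ 0) (hz : z ≠ 0) : theta q z = z * theta q (q * z) := by
  rw [theta, theta]
  rw [← (Equiv.addRight (1 : ℤ)).tsum_eq, ← tsum_mul_left]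
  refine tsum_congr fun n => ?_
  rw [Equiv.coe_addRight, tri_add, mul_one, show tri 1 = 0 from rfl, add_zero, zpow_add₀ hq0,
    zpow_add_one₀ hz, mul_zpow]
  ring

lemma theta_dissection (hq0 : q ≠ 0) (hq : ‖q‖ < 1) (hz : z ≠ 0) (m : ℕ) [NeZero m] :
    theta q z = ∑ r ∈ Finset.range m, q ^ r.choose 2 * z ^ r *
      theta (q ^ m ^ 2) (q ^ (m * r + m.choose 2) * z ^ m) := by
  rw [Finset.sum_range]
  have h := (Int.divModEquiv m).symm.hasSum_iff.mpr (hasSum_theta hq0 hq hz)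
  have h' := (Equiv.prodComm _ _).hasSum_iff.mpr h
  refine (h'.prod_fiberwise fun r => ?_).unique (hasSum_fintype _)
  refine ((hasSum_theta (pow_ne_zero _ hq0) (norm_pow_lt_one hq (pow_ne_zero 2 (NeZero.ne m)))
    (mul_ne_zero (pow_ne_zero _ hq0) (pow_ne_zero _ hz))).mul_left _).congr_fun fun n => ?_
  have htri : tri (n * m + r) =
      r.val.choose 2 + ((m ^ 2 : ℕ) * tri n + ((m * r.val + m.choose 2 : ℕ) : ℤ) * n) := by
    rw [mul_comm, tri_add, tri_mul, tri_natCast, tri_natCast]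
    push_cast
    ring
  have hpow : z ^ (n * m + r) = z ^ r.val * z ^ (m * n) := by
    rw [zpow_add₀ hz, zpow_natCast, mul_comm, mul_comm n]
  simp only [Function.comp_apply, Equiv.prodComm_apply, Prod.swap_prod_mk,
    Int.divModEquiv_symm_apply]
  rw [htri, hpow, zpow_add₀ hq0, zpow_add₀ hq0, zpow_mul, zpow_mul, zpow_mul, zpow_natCast,
    zpow_natCast, zpow_natCast, zpow_natCast, mul_zpow]
  ring

/-- The bijection `(s, u, v) ↦ (a u + v + s, a v - u)`, which writes `ℤ × ℤ` as the union of the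
`a ^ 2 + 1` cosets of the lattice `{(a u + v, a v - u)}`. -/
def schroeterEquiv (a : ℕ) : Fin (a ^ 2 + 1) × ℤ × ℤ ≃ ℤ × ℤ where
  toFun p := (a * p.2.1 + p.2.2 + p.1, a * p.2.2 - p.2.1)
  invFun p :=
    let d := Int.divModEquiv (a ^ 2 + 1) (p.1 + a * p.2)
    (d.2, a * d.1 - p.2, d.1)
  left_inv := by
    rintro ⟨s, u, v⟩
    have h : a * u + v + s + a * (a * v - u) = (Int.divModEquiv (a ^ 2 + 1)).symm (v, s) := by
      rw [Int.divModEquiv_symm_apply]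
      push_cast
      ring
    simp only [h, Equiv.apply_symm_apply]
    simp
  right_inv := by
    rintro ⟨x, y⟩
    have h := (Int.divModEquiv (a ^ 2 + 1)).symm_apply_apply (x + a * y)
    rw [Int.divModEquiv_symm_apply] at h
    push_cast at h
    ext
    · dsimp only
      linear_combination h
    · simp

-- Schröter's formula: the lattice spanned by `(a, -1)` and `(1, a)` is orthogonal, so that on each
-- of its cosets the exponent separates into the exponents of two theta series.
theorem theta_mul_theta (hq0 : q ≠ 0) (hq : ‖q‖ < 1) (hz : z ≠ 0) (hw : w ≠ 0) (a : ℕ) :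
    theta q z * theta q w = ∑ s ∈ Finset.range (a ^ 2 + 1), q ^ s.choose 2 * z ^ s *
      (theta (q ^ (a ^ 2 + 1)) (q ^ (a.choose 2 + 1 + a * s) * z ^ a / w) *
        theta (q ^ (a ^ 2 + 1)) (q ^ (a.choose 2 + s) * z * w ^ a)) := by
  rw [Finset.sum_range]
  have hN : ‖q ^ (a ^ 2 + 1)‖ < 1 := norm_pow_lt_one hq (Nat.succ_ne_zero _)
  have hθ : ∀ {x : ℂ}, x ≠ 0 →
      HasSum (fun n : ℤ => (q ^ (a ^ 2 + 1)) ^ tri n * x ^ n) (theta (q ^ (a ^ 2 + 1)) x) :=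
    hasSum_theta (pow_ne_zero _ hq0) hN
  refine (((schroeterEquiv a).hasSum_iff.mpr (hasSum_prod_mul (hasSum_theta hq0 hq hz)
    (hasSum_theta hq0 hq hw))).prod_fiberwise fun s => ?_).unique (hasSum_fintype _)
  refine ((hasSum_prod_mul (hθ ?_) (hθ ?_)).mul_left _).congr_fun fun ⟨u, v⟩ => ?_
  · exact div_ne_zero (mul_ne_zero (pow_ne_zero _ hq0) (pow_ne_zero _ hz)) hw
  · exact mul_ne_zero (mul_ne_zero (pow_ne_zero _ hq0) hz) (pow_ne_zero _ hw)
  have htri : tri (a * u + v + s) + tri (a * v - u) = s.val.choose 2 +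
      ((a ^ 2 + 1 : ℕ) * tri u + (a.choose 2 + 1 + a * s.val : ℕ) * u) +
      ((a ^ 2 + 1 : ℕ) * tri v + (a.choose 2 + s.val : ℕ) * v) := by
    rw [sub_eq_add_neg, tri_add, tri_add, tri_add (a * v), tri_neg, tri_mul, tri_mul,
      tri_natCast, tri_natCast]
    push_cast
    ring
  have hq' : q ^ tri (a * u + v + s) * q ^ tri (a * v - u) = q ^ s.val.choose 2 *
      ((q ^ (a ^ 2 + 1)) ^ tri u * (q ^ (a.choose 2 + 1 + a * s.val)) ^ u) *
      ((q ^ (a ^ 2 + 1)) ^ tri v * (q ^ (a.choose 2 + s.val)) ^ v) := by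
    simp only [← zpow_natCast, ← zpow_mul, ← zpow_add₀ hq0, htri]
  have hz' : z ^ (a * u + v + s) = (z ^ a) ^ u * z ^ v * z ^ s.val := by
    rw [zpow_add₀ hz, zpow_add₀ hz, zpow_mul, zpow_natCast, zpow_natCast]
  have hw' : w ^ (a * v - u) = (w ^ a) ^ v / w ^ u := by
    rw [zpow_sub₀ hw, zpow_mul, zpow_natCast]
  simp only [Function.comp_apply, schroeterEquiv, Equiv.coe_fn_mk]
  rw [mul_mul_mul_comm, hq', hz', hw', div_zpow, mul_zpow, mul_zpow, mul_zpow]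
  ring

lemma prod_theta (hq0 : q ≠ 0) (hq : ‖q‖ < 1) (hz : z ≠ 0) (m : ℕ) [NeZero m] :
    (∏ i ∈ Finset.range m, theta (q ^ m) (q ^ i * z)) * qProduct q q =
      qProduct (q ^ m) (q ^ m) ^ m * theta q z := by
  rw [Finset.prod_range]
  have hrev : ∏ i : Fin m, qProduct (-(q ^ m / (q ^ (i : ℕ) * z))) (q ^ m) =
      qProduct (-(q / z)) q := by
    rw [qProduct_eq_prod _ hq m, ← Equiv.prod_comp Fin.revPerm]
    refine Finset.prod_congr rfl fun i _ => ?_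
    have hm : q ^ m = q * q ^ (m - (i + 1)) * q ^ (i : ℕ) := by
      rw [← pow_succ', ← pow_add]
      congr 1
      omega
    rw [Fin.revPerm_apply, Fin.val_rev]
    congr 1
    rw [hm]
    field_simp
  have hfactor (i : Fin m) := theta_eq_qProduct (pow_ne_zero m hq0)
    (norm_pow_lt_one hq (NeZero.ne m)) (mul_ne_zero (pow_ne_zero i hq0) hz)
  simp only [hfactor, Finset.prod_mul_distrib, Finset.prod_const, Finset.card_univ,
    Fintype.card_fin, hrev]
  rw [theta_eq_qProduct hq0 hq hz, qProduct_eq_prod (-z) hq m]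
  simp only [neg_mul, mul_comm z]
  ring

end Theta

section EulerProducts

variable {q : ℂ}

lemma eulerE_ne_zero (hq : ‖q‖ < 1) (n : ℕ) [NeZero n] : eulerE n q ≠ 0 :=
  qProduct_ne_zero_of_norm_lt_one (norm_pow_lt_one hq (NeZero.ne n))
    (norm_pow_lt_one hq (NeZero.ne n))

lemma eulerE_pow (n k : ℕ) (q : ℂ) : eulerE n (q ^ k) = eulerE (k * n) q := by
  rw [eulerE, eulerE, ← pow_mul]

lemma eulerE_neg_of_even {n : ℕ} (hn : Even n) (q : ℂ) : eulerE n (-q) = eulerE n q := by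
  rw [eulerE, eulerE, hn.neg_pow]

lemma qProduct_neg_self (hq : ‖q‖ < 1) : qProduct (-q) q = eulerE 2 q / eulerE 1 q := by
  rw [eq_div_iff (eulerE_ne_zero hq 1), mul_comm, eulerE, pow_one, qProduct_mul_qProduct_neg q hq,
    eulerE]

lemma qProduct_self_sq (hq : ‖q‖ < 1) : qProduct q (q ^ 2) = eulerE 1 q / eulerE 2 q := by
  rw [eq_div_iff (eulerE_ne_zero hq 2), eulerE, eulerE, pow_one, qProduct_eq_prod q hq 2,
    Fin.prod_univ_two, Fin.val_zero, Fin.val_one, pow_zero, mul_one, pow_one, ← pow_two]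

lemma eulerE_one_neg (hq : ‖q‖ < 1) :
    eulerE 1 (-q) = eulerE 2 q ^ 3 / (eulerE 1 q * eulerE 4 q) := by
  have h₁ := eulerE_ne_zero hq 1
  have h₂ := eulerE_ne_zero hq 2
  have h₄ := eulerE_ne_zero hq 4
  have hq₂ := norm_pow_lt_one hq two_ne_zero
  have hmul := qProduct_mul_qProduct_neg q hq₂
  rw [qProduct_self_sq hq₂, eulerE_pow, eulerE_pow, qProduct_self_sq hq] at hmul
  have hneg := qProduct_self_sq (q := -q) (by rwa [norm_neg])
  rw [neg_sq, eulerE_neg_of_even even_two] at hneg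
  rw [hneg] at hmul
  field_simp at hmul ⊢
  exact hmul

lemma eulerE_neg_of_odd (hq : ‖q‖ < 1) {n : ℕ} (hn : Odd n) :
    eulerE n (-q) = eulerE (2 * n) q ^ 3 / (eulerE n q * eulerE (4 * n) q) := by
  have h := eulerE_one_neg (norm_pow_lt_one hq hn.pos.ne')
  rw [← hn.neg_pow, eulerE_pow, eulerE_pow, eulerE_pow, eulerE_pow] at h
  simpa only [mul_comm, mul_one] using h

lemma theta_one (hq0 : q ≠ 0) (hq : ‖q‖ < 1) :
    theta q 1 = 2 * eulerE 2 q ^ 2 / eulerE 1 q := by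
  have h₁ := eulerE_ne_zero hq 1
  rw [theta_eq_qProduct hq0 hq one_ne_zero, div_one, qProduct_eq_one_sub_mul (-1) hq, neg_one_mul,
    qProduct_neg_self hq, show qProduct q q = eulerE 1 q by rw [eulerE, pow_one]]
  field_simp
  ring

lemma theta_sq_neg (hq0 : q ≠ 0) (hq : ‖q‖ < 1) :
    theta (q ^ 2) (-q) = eulerE 1 q ^ 2 / eulerE 2 q := by
  have h₂ := eulerE_ne_zero hq 2
  rw [theta_eq_qProduct (pow_ne_zero 2 hq0) (norm_pow_lt_one hq two_ne_zero) (neg_ne_zero.mpr hq0),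
    neg_neg, div_neg, neg_neg, pow_two q, mul_self_div_self, ← pow_two, qProduct_self_sq hq,
    ← eulerE]
  field_simp

lemma theta_pow_symm (hq0 : q ≠ 0) {m n N : ℕ} (h : m + n = N) :
    theta (q ^ N) (q ^ m) = theta (q ^ N) (q ^ n) := by
  rw [← theta_div (pow_ne_zero N hq0), ← h, pow_add, mul_div_cancel_left₀ _ (pow_ne_zero m hq0)]

lemma theta_pow_eq_mul (hq0 : q ≠ 0) {m n N : ℕ} (h : N + m = n) :
    theta (q ^ N) (q ^ m) = q ^ m * theta (q ^ N) (q ^ n) := by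
  rw [theta_eq_mul (pow_ne_zero N hq0) (pow_ne_zero m hq0), ← pow_add, h]

lemma theta_pow_mul_theta_pow (hq0 : q ≠ 0) (hq : ‖q‖ < 1) {N j : ℕ} [NeZero N] (hj : j ≤ N)
    (i a : ℕ) :
    theta (q ^ N) (q ^ i) * theta (q ^ N) (q ^ j) =
      ∑ s ∈ Finset.range (a ^ 2 + 1), q ^ (N * s.choose 2 + i * s) *
        (theta (q ^ (N * (a ^ 2 + 1))) (q ^ (N * (a.choose 2 + a * s) + a * i + (N - j))) *
          theta (q ^ (N * (a ^ 2 + 1))) (q ^ (N * (a.choose 2 + s) + i + a * j))) := by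
  rw [theta_mul_theta (pow_ne_zero N hq0) (norm_pow_lt_one hq (NeZero.ne N)) (pow_ne_zero i hq0)
    (pow_ne_zero j hq0) a]
  have hsub : q ^ N / q ^ j = q ^ (N - j) := (pow_sub₀ q hq0 hj).symm
  refine Finset.sum_congr rfl fun s _ => ?_
  have hdiv : (q ^ N) ^ (a.choose 2 + 1 + a * s) * (q ^ i) ^ a / q ^ j =
      q ^ (N * (a.choose 2 + a * s) + a * i + (N - j)) := by
    rw [pow_add _ _ (N - j), ← hsub]
    ring
  rw [hdiv]
  simp only [← pow_mul, ← pow_add, mul_comm a]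

lemma theta_one_sq (hq0 : q ≠ 0) (hq : ‖q‖ < 1) :
    theta q 1 ^ 2 = 4 * (theta (q ^ 5) q * theta (q ^ 5) (q ^ 2)) + q * theta (q ^ 5) 1 ^ 2 := by
  have h := theta_pow_mul_theta_pow hq0 hq (Nat.zero_le 1) 0 2
  simp only [Finset.sum_range_succ, Finset.range_one, Finset.sum_singleton, Nat.choose,
    Nat.reducePow, Nat.reduceAdd, Nat.reduceMul, tsub_zero, pow_zero, pow_one, mul_zero, zero_mul,
    mul_one, one_mul, add_zero] at h
  have h₃ := theta_pow_symm hq0 (show 3 + 2 = 5 from rfl)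
  have h₄ := theta_pow_symm hq0 (show 4 + 1 = 5 from rfl)
  have h₅ := theta_pow_symm hq0 (show 5 + 0 = 5 from rfl)
  have h₆ := theta_pow_eq_mul hq0 (show 5 + 1 = 6 from rfl)
  have h₈ := theta_pow_eq_mul hq0 (show 5 + 3 = 8 from rfl)
  have h₁₀ := theta_pow_eq_mul hq0 (show 5 + 5 = 10 from rfl)
  rw [h₃] at h h₈
  rw [h₄] at h
  rw [h₅] at h h₁₀
  simp only [pow_zero, pow_one] at h h₆ h₁₀
  linear_combination h - theta (q ^ 5) (q ^ 2) * h₆ - theta (q ^ 5) q * h₈ -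
    q * theta (q ^ 5) 1 * h₁₀

lemma theta_sq_self_sq (hq0 : q ≠ 0) (hq : ‖q‖ < 1) :
    theta (q ^ 2) q ^ 2 = theta (q ^ 10) (q ^ 5) ^ 2 +
      4 * q * (theta (q ^ 10) q * theta (q ^ 10) (q ^ 3)) := by
  have h := theta_pow_mul_theta_pow hq0 hq one_le_two 1 2
  simp only [Finset.sum_range_succ, Finset.range_one, Finset.sum_singleton, Nat.choose,
    Nat.reducePow, Nat.reduceAdd, Nat.reduceMul, Nat.reduceSub, pow_zero, pow_one, mul_zero,
    mul_one, one_mul, add_zero, zero_add] at h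
  have h₇ := theta_pow_symm hq0 (show 7 + 3 = 10 from rfl)
  have h₉ := theta_pow_symm hq0 (show 9 + 1 = 10 from rfl)
  have h₁₁ := theta_pow_eq_mul hq0 (show 10 + 1 = 11 from rfl)
  have h₁₃ := theta_pow_eq_mul hq0 (show 10 + 3 = 13 from rfl)
  have h₁₇ := theta_pow_eq_mul hq0 (show 10 + 7 = 17 from rfl)
  have h₂₁ := theta_pow_eq_mul hq0 (show 10 + 11 = 21 from rfl)
  rw [h₇] at h h₁₇
  rw [h₉] at h
  simp only [pow_one] at h h₁₁
  rw [h₂₁] at h h₁₁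
  linear_combination h - (q * theta (q ^ 10) q + q ^ 13 * theta (q ^ 10) (q ^ 21)) * h₁₃ -
    q ^ 13 * theta (q ^ 10) (q ^ 21) * h₁₇ - 2 * q * theta (q ^ 10) (q ^ 3) * h₁₁

lemma theta_mul_theta_sq (hq0 : q ≠ 0) (hq : ‖q‖ < 1) :
    theta (q ^ 5) q * theta (q ^ 5) (q ^ 2) = theta (q ^ 10) (q ^ 4) * theta (q ^ 10) (q ^ 3) +
      q * (theta (q ^ 10) q * theta (q ^ 10) (q ^ 2)) := by
  have h := theta_pow_mul_theta_pow hq0 hq (show 2 ≤ 5 by norm_num) 1 1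
  simp only [Finset.sum_range_succ, Finset.range_one, Finset.sum_singleton, Nat.choose,
    Nat.reduceAdd, Nat.reduceMul, Nat.reduceSub, pow_zero, pow_one, one_pow, mul_zero, mul_one,
    one_mul, add_zero, zero_add] at h
  rw [h, theta_pow_symm hq0 (show 9 + 1 = 10 from rfl),
    theta_pow_symm hq0 (show 8 + 2 = 10 from rfl), pow_one]

lemma theta_mul_theta_eq_eulerE (hq0 : q ≠ 0) (hq : ‖q‖ < 1) :
    theta (q ^ 5) q * theta (q ^ 5) (q ^ 2) =
      eulerE 2 q * eulerE 5 q ^ 3 / (eulerE 1 q * eulerE 10 q) := by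
  have h₁ := eulerE_ne_zero hq 1
  have h₅ := eulerE_ne_zero hq 5
  have h₁₀ := eulerE_ne_zero hq 10
  have hq₅ : ‖q ^ 5‖ < 1 := norm_pow_lt_one hq (by norm_num)
  have hE : qProduct (q ^ 5) (q ^ 5) = eulerE 5 q := rfl
  have hsplit := qProduct_neg_self hq
  have hlast := qProduct_neg_self hq₅
  rw [eulerE_pow, eulerE_pow] at hlast
  rw [qProduct_eq_prod (-q) hq 5] at hsplit
  simp only [Fin.prod_univ_five, Fin.isValue, Fin.coe_ofNat_eq_mod, Nat.zero_mod, Nat.one_mod,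
    Nat.mod_succ, Nat.reduceMod, Nat.reduceAdd, Nat.reduceMul, ← pow_succ', pow_one, neg_mul,
    zero_add, mul_one] at hsplit hlast
  rw [hlast] at hsplit
  rw [theta_eq_qProduct (pow_ne_zero 5 hq0) hq₅ hq0,
    theta_eq_qProduct (pow_ne_zero 5 hq0) hq₅ (pow_ne_zero 2 hq0), hE,
    show q ^ 5 / q = q ^ 4 by field_simp, show q ^ 5 / q ^ 2 = q ^ 3 by field_simp]
  field_simp at hsplit ⊢
  linear_combination hsplit

lemma theta_neg_mul_theta_neg_eq_eulerE (hq0 : q ≠ 0) (hq : ‖q‖ < 1) :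
    theta (q ^ 10) (-q) * theta (q ^ 10) (-q ^ 3) =
      eulerE 1 q * eulerE 10 q ^ 3 / (eulerE 2 q * eulerE 5 q) := by
  have h₂ := eulerE_ne_zero hq 2
  have h₅ := eulerE_ne_zero hq 5
  have h₁₀ := eulerE_ne_zero hq 10
  have hq₁₀ : ‖q ^ 10‖ < 1 := norm_pow_lt_one hq (by norm_num)
  have hE : qProduct (q ^ 10) (q ^ 10) = eulerE 10 q := rfl
  have hsplit := qProduct_self_sq hq
  have hlast := qProduct_self_sq (norm_pow_lt_one hq (show 5 ≠ 0 by norm_num))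
  rw [eulerE_pow, eulerE_pow] at hlast
  rw [qProduct_eq_prod q (norm_pow_lt_one hq two_ne_zero) 5] at hsplit
  simp only [Fin.prod_univ_five, Fin.isValue, Fin.coe_ofNat_eq_mod, Nat.zero_mod, Nat.one_mod,
    Nat.mod_succ, Nat.reduceMod, Nat.reduceAdd, Nat.reduceMul, ← pow_mul, ← pow_succ', pow_one,
    mul_zero, zero_add, mul_one] at hsplit hlast
  rw [hlast] at hsplit
  rw [theta_eq_qProduct (pow_ne_zero 10 hq0) hq₁₀ (neg_ne_zero.mpr hq0),
    theta_eq_qProduct (pow_ne_zero 10 hq0) hq₁₀ (neg_ne_zero.mpr (pow_ne_zero 3 hq0)), hE,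
    div_neg, div_neg, neg_neg, neg_neg, neg_neg, neg_neg,
    show q ^ 10 / q = q ^ 9 by field_simp, show q ^ 10 / q ^ 3 = q ^ 7 by field_simp]
  field_simp at hsplit ⊢
  linear_combination hsplit

lemma eulerE_psi_sq_sub (hq0 : q ≠ 0) (hq : ‖q‖ < 1) :
    eulerE 2 q ^ 4 / eulerE 1 q ^ 2 - q * eulerE 10 q ^ 4 / eulerE 5 q ^ 2 =
      eulerE 2 q * eulerE 5 q ^ 3 / (eulerE 1 q * eulerE 10 q) := by
  have h := theta_one_sq hq0 hq
  rw [theta_mul_theta_eq_eulerE hq0 hq, theta_one hq0 hq,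
    theta_one (pow_ne_zero 5 hq0) (norm_pow_lt_one hq (by norm_num)), eulerE_pow, eulerE_pow] at h
  linear_combination h / 4

lemma eulerE_phi_sq_sub (hq0 : q ≠ 0) (hq : ‖q‖ < 1) :
    eulerE 1 q ^ 4 / eulerE 2 q ^ 2 - eulerE 5 q ^ 4 / eulerE 10 q ^ 2 =
      -4 * q * (eulerE 1 q * eulerE 10 q ^ 3 / (eulerE 2 q * eulerE 5 q)) := by
  have h := theta_sq_self_sq (neg_ne_zero.mpr hq0) (by rwa [norm_neg])
  have h₅ := theta_sq_neg (pow_ne_zero 5 hq0) (norm_pow_lt_one hq (by norm_num))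
  rw [← pow_mul, eulerE_pow, eulerE_pow] at h₅
  rw [neg_sq, theta_sq_neg hq0 hq, Even.neg_pow (by decide), Odd.neg_pow (by decide),
    Odd.neg_pow (by decide), theta_neg_mul_theta_neg_eq_eulerE hq0 hq, h₅] at h
  linear_combination h

lemma theta_sq_mul_theta_eq_eulerE (hq0 : q ≠ 0) (hq : ‖q‖ < 1) :
    theta (q ^ 10) (q ^ 2) * theta (q ^ 10) (q ^ 4) =
      eulerE 4 q * eulerE 10 q ^ 3 / (eulerE 2 q * eulerE 20 q) := by
  have h := theta_mul_theta_eq_eulerE (pow_ne_zero 2 hq0) (norm_pow_lt_one hq two_ne_zero)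
  simpa only [← pow_mul, eulerE_pow] using h

lemma theta_mul_sq_add_theta_mul_sq (hq0 : q ≠ 0) (hq : ‖q‖ < 1) :
    theta (q ^ 5) (q ^ 2) * theta (q ^ 10) (q ^ 4) ^ 2 +
        q * (theta (q ^ 5) q * theta (q ^ 10) (q ^ 2) ^ 2) =
      eulerE 4 q * eulerE 5 q ^ 4 / (eulerE 1 q * eulerE 20 q) := by
  have h₁ := eulerE_ne_zero hq 1
  have h₂ := eulerE_ne_zero hq 2
  have h₁₀ := eulerE_ne_zero hq 10
  have h₂₀ := eulerE_ne_zero hq 20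
  have hq₅ : ‖q ^ 5‖ < 1 := norm_pow_lt_one hq (by norm_num)
  have hB := prod_theta (pow_ne_zero 5 hq0) hq₅ hq0 2
  have hA := prod_theta (pow_ne_zero 5 hq0) hq₅ (pow_ne_zero 2 hq0) 2
  simp only [Finset.prod_range_succ, Finset.range_one, Finset.prod_singleton, Nat.reduceAdd,
    Nat.reduceMul, ← pow_mul, ← pow_add, ← pow_succ, pow_one, mul_zero, zero_add, mul_one] at hA hB
  rw [theta_pow_symm hq0 (show 6 + 4 = 10 from rfl), ← eulerE, ← eulerE] at hB
  rw [theta_pow_symm hq0 (show 7 + 3 = 10 from rfl), ← eulerE, ← eulerE] at hA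
  have hAB := theta_mul_theta_eq_eulerE hq0 hq
  have hAB' := theta_sq_mul_theta_eq_eulerE hq0 hq
  have hsum : eulerE 10 q ^ 2 * (theta (q ^ 5) (q ^ 2) * theta (q ^ 10) (q ^ 4) ^ 2 +
      q * (theta (q ^ 5) q * theta (q ^ 10) (q ^ 2) ^ 2)) =
      eulerE 5 q * (theta (q ^ 10) (q ^ 2) * theta (q ^ 10) (q ^ 4)) *
        (theta (q ^ 5) q * theta (q ^ 5) (q ^ 2)) := by
    rw [theta_mul_theta_sq hq0 hq]
    linear_combination -theta (q ^ 10) (q ^ 4) ^ 2 * hA - q * theta (q ^ 10) (q ^ 2) ^ 2 * hB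
  rw [hAB, hAB'] at hsum
  refine mul_left_cancel₀ (pow_ne_zero 2 h₁₀) (hsum.trans ?_)
  field_simp

end EulerProducts

section Beads

/-- The `i`-th bead of a Young diagram `μ` on the integer line (its Maya diagram, or abacus). -/
def bead (μ : YoungDiagram) (i : ℕ) : ℤ := i - μ.rowLen i

lemma strictMono_bead (μ : YoungDiagram) : StrictMono (bead μ) :=
  strictMono_nat_of_lt_succ fun i => by
    have := μ.rowLen_anti i (i + 1) (Nat.le_succ i)
    simp only [bead]
    omega

lemma lt_colLen_iff_lt_rowLen (μ : YoungDiagram) (i j : ℕ) : i < μ.colLen j ↔ j < μ.rowLen i := by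
  rw [← YoungDiagram.mem_iff_lt_colLen, YoungDiagram.mem_iff_lt_rowLen]

lemma bead_eq_self (μ : YoungDiagram) {i : ℕ} (hi : μ.colLen 0 ≤ i) : bead μ i = i := by
  have := lt_colLen_iff_lt_rowLen μ i 0
  simp only [bead]
  omega

lemma bead_ne_colLen_sub (μ : YoungDiagram) (i j : ℕ) : bead μ i ≠ μ.colLen j - j - 1 := by
  have := lt_colLen_iff_lt_rowLen μ i j
  simp only [bead]
  omega

lemma exists_eq_colLen_sub_of_notMem_range_bead (μ : YoungDiagram) {s : ℤ}
    (hs : s ∉ Set.range (bead μ)) : ∃ j : ℕ, s = μ.colLen j - j - 1 := by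
  classical
  have hex : ∃ i, s < bead μ i :=
    ⟨(s + 1).toNat + μ.colLen 0, by rw [bead_eq_self μ (Nat.le_add_left _ _)]; omega⟩
  obtain ⟨i, hi, hmin⟩ : ∃ i, s < bead μ i ∧ ∀ i' < i, bead μ i' ≤ s :=
    ⟨Nat.find hex, Nat.find_spec hex, fun _ h => not_lt.mp (Nat.find_min hex h)⟩
  refine ⟨(i - 1 - s).toNat, ?_⟩
  have hcol := lt_colLen_iff_lt_rowLen μ i (i - 1 - s).toNat
  simp only [bead] at hi
  rcases i with _ | i
  · omega
  · have hcol' := lt_colLen_iff_lt_rowLen μ i ((i + 1 : ℕ) - 1 - s).toNat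
    have hlt : bead μ i < s :=
      (hmin i (Nat.lt_succ_self i)).lt_of_ne fun h => hs ⟨i, h⟩
    simp only [bead] at hlt
    omega

lemma hookNumber_eq (μ : YoungDiagram) (i j : ℕ) :
    hookNumber μ i j = μ.colLen j - j - 1 - bead μ i := by
  simp only [hookNumber, bead]
  ring

lemma hookNumber_pos_iff (μ : YoungDiagram) (i j : ℕ) : 0 < hookNumber μ i j ↔ (i, j) ∈ μ := by
  have := lt_colLen_iff_lt_rowLen μ i j
  rw [YoungDiagram.mem_iff_lt_rowLen, hookNumber]
  omega

lemma forall_not_dvd_hookNumber_iff (μ : YoungDiagram) (t : ℕ) [NeZero t] :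
    (∀ c ∈ μ.cells, ¬ (t : ℤ) ∣ hookNumber μ c.1 c.2) ↔
      ∀ s ∈ Set.range (bead μ), s + t ∈ Set.range (bead μ) := by
  have ht : 0 < t := NeZero.pos t
  constructor
  · rintro h _ ⟨i, rfl⟩
    by_contra hs
    obtain ⟨j, hj⟩ := exists_eq_colLen_sub_of_notMem_range_bead μ hs
    have hook : hookNumber μ i j = t := by rw [hookNumber_eq]; omega
    exact h (i, j) ((hookNumber_pos_iff μ i j).mp (by omega)) (by simp only [hook, dvd_refl])
  · rintro h ⟨i, j⟩ hc ⟨k, hk⟩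
    have hpos := (hookNumber_pos_iff μ i j).mpr hc
    have hk0 : 0 < k := pos_of_mul_pos_right (hk ▸ hpos) (Int.natCast_nonneg t)
    have hshift : ∀ m : ℕ, bead μ i + t * m ∈ Set.range (bead μ) := by
      intro m
      induction m with
      | zero => simp
      | succ m ih =>
        have := h _ ih
        rwa [add_assoc, ← mul_add_one, ← Nat.cast_succ] at this
    obtain ⟨i', hi'⟩ := hshift k.toNat
    refine bead_ne_colLen_sub μ i' j ?_
    rw [hi', Int.toNat_of_nonneg hk0.le, ← hk, hookNumber_eq]
    ring

lemma eq_of_forall_rowLen_eq {μ ν : YoungDiagram} (h : ∀ i, μ.rowLen i = ν.rowLen i) : μ = ν := by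
  refine YoungDiagram.ext (Finset.ext fun ⟨i, j⟩ => ?_)
  rw [YoungDiagram.mem_cells, YoungDiagram.mem_cells, YoungDiagram.mem_iff_lt_rowLen,
    YoungDiagram.mem_iff_lt_rowLen, h i]

lemma eq_of_range_bead_eq {μ ν : YoungDiagram}
    (h : Set.range (bead μ) = Set.range (bead ν)) : μ = ν := by
  have hbead := ((strictMono_bead μ).range_inj (strictMono_bead ν)).mp h
  refine eq_of_forall_rowLen_eq fun i => ?_
  have := congrFun hbead i
  simp only [bead] at this
  omega

lemma exists_rowLen_eq {l : ℕ → ℕ} (hl : Antitone l) {N : ℕ} (hN : ∀ i ≥ N, l i = 0) :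
    ∃ μ : YoungDiagram, ∀ i, μ.rowLen i = l i := by
  have hmem : ∀ i j, (i, j) ∈ (Finset.range N ×ˢ Finset.range (l 0)).filter
      (fun c => c.2 < l c.1) ↔ j < l i := by
    intro i j
    have h1 := hl (Nat.zero_le i)
    have h2 := hN i
    simp only [Finset.mem_filter, Finset.mem_product, Finset.mem_range]
    omega
  let μ : YoungDiagram :=
    { cells := (Finset.range N ×ˢ Finset.range (l 0)).filter fun c => c.2 < l c.1
      isLowerSet := by
        rintro ⟨i, j⟩ ⟨i', j'⟩ ⟨hi, hj⟩ hc
        rw [Finset.mem_coe, hmem] at hc ⊢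
        exact (hj.trans_lt hc).trans_le (hl hi) }
  refine ⟨μ, fun i => eq_of_forall_lt_iff fun j => ?_⟩
  rw [← YoungDiagram.mem_iff_lt_rowLen]
  exact hmem i j

lemma exists_bead_eq {f : ℕ → ℤ} (hf : StrictMono f) {N : ℕ} (hN : ∀ i ≥ N, f i = i) :
    ∃ μ : YoungDiagram, bead μ = f := by
  have hanti : Antitone fun i : ℕ => (i : ℤ) - f i :=
    antitone_nat_of_succ_le fun i => by
      have := hf (Nat.lt_add_one i)
      push_cast
      omega
  have hzero : ∀ i ≥ N, (i : ℤ) - f i = 0 := fun i hi => sub_eq_zero.mpr (hN i hi).symm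
  have hnonneg : ∀ i : ℕ, 0 ≤ (i : ℤ) - f i := fun i =>
    (hzero (i + N) (Nat.le_add_left N i)).ge.trans (hanti (Nat.le_add_right i N))
  obtain ⟨μ, hμ⟩ := exists_rowLen_eq (l := fun i : ℕ => ((i : ℤ) - f i).toNat)
    (fun i j hij => Int.toNat_le_toNat (hanti hij)) (N := N)
    fun i hi => by rw [hzero i hi, Int.toNat_zero]
  refine ⟨μ, funext fun i => ?_⟩
  rw [bead, hμ, Int.toNat_of_nonneg (hnonneg i), sub_sub_cancel]

lemma card_eq_sum_rowLen (μ : YoungDiagram) {N : ℕ} (hN : μ.colLen 0 ≤ N) :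
    μ.card = ∑ i ∈ Finset.range N, μ.rowLen i := by
  have h : ∀ c ∈ μ.cells, c.1 ∈ Finset.range N := by
    rintro ⟨i, j⟩ hc
    exact Finset.mem_range.mpr ((YoungDiagram.mem_iff_lt_colLen.mp
      (μ.up_left_mem le_rfl (Nat.zero_le j) ((YoungDiagram.mem_cells _).mp hc))).trans_le hN)
  rw [YoungDiagram.card, Finset.card_eq_sum_card_fiberwise h]
  refine Finset.sum_congr rfl fun i _ => ?_
  rw [YoungDiagram.rowLen_eq_card]
  rfl

end Beads

section Abacus

lemma exists_strictMono_range_eq {S : Set ℤ} (hbelow : BddBelow S) (habove : ¬ BddAbove S) :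
    ∃ f : ℕ → ℤ, StrictMono f ∧ Set.range f = S := by
  obtain ⟨b, hb⟩ := hbelow
  let p : ℕ → Prop := fun m => (m : ℤ) + b ∈ S
  have hcast : ∀ s ∈ S, ((s - b).toNat : ℤ) + b = s := fun s hs => by
    have := hb hs
    omega
  have hinf : {m | p m}.Infinite := Set.infinite_of_forall_exists_gt fun a => by
    obtain ⟨s, hs, has⟩ := not_bddAbove_iff.mp habove (a + b)
    exact ⟨(s - b).toNat, show ((s - b).toNat : ℤ) + b ∈ S from (hcast s hs).symm ▸ hs, by omega⟩
  refine ⟨fun i => Nat.nth p i + b, fun i j hij => ?_, Set.ext fun s => ⟨?_, fun hs => ?_⟩⟩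
  · simpa only [add_lt_add_iff_right, Nat.cast_lt] using Nat.nth_strictMono hinf hij
  · rintro ⟨i, rfl⟩
    exact Nat.nth_mem_of_infinite hinf i
  · obtain ⟨i, hi⟩ : (s - b).toNat ∈ Set.range (Nat.nth p) := by
      rw [Nat.range_nth_of_infinite hinf]
      exact show ((s - b).toNat : ℤ) + b ∈ S from (hcast s hs).symm ▸ hs
    exact ⟨i, by simp only [hi, hcast s hs]⟩

lemma eq_add_of_strictMono_of_Ici_subset_range {f : ℕ → ℤ} (hf : StrictMono f) {m : ℕ}
    (hm : Set.Ici (f m) ⊆ Set.range f) (j : ℕ) : f (m + j) = f m + j := by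
  induction j with
  | zero => simp
  | succ j ih =>
    have hlt : f (m + j) < f (m + (j + 1)) := hf (by omega)
    obtain ⟨l, hl⟩ := hm (show f m + (j + 1 : ℕ) ∈ Set.Ici (f m) from by simp [add_nonneg])
    have hjl : m + j < l := hf.lt_iff_lt.mp (by rw [hl, ih]; push_cast; omega)
    have hle : f (m + (j + 1)) ≤ f l := hf.monotone hjl
    push_cast at hl ⊢
    omega

variable {t : ℕ} [NeZero t] {v : Fin t → ℤ}

/-- The bead positions on the abacus with `t` runners on which the beads of the `r`-th runner
are the integers `k * t + r` with `k ≥ v r`, i.e. are flush. These are the bead sets of `t`-cores,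
up to a shift. -/
def runnerSet (v : Fin t → ℤ) : Set ℤ :=
  {s | v (Int.divModEquiv t s).2 ≤ (Int.divModEquiv t s).1}

lemma mul_add_mem_runnerSet_iff {r : Fin t} {k : ℤ} : k * t + r ∈ runnerSet v ↔ v r ≤ k := by
  rw [← Int.divModEquiv_symm_apply t (k, r), runnerSet, Set.mem_ofPred_eq, Equiv.apply_symm_apply]

lemma runnerSet_injective : Function.Injective (runnerSet : (Fin t → ℤ) → Set ℤ) :=
  fun v w h => funext fun r => eq_of_forall_ge_iff fun k => by
    rw [← mul_add_mem_runnerSet_iff, h, mul_add_mem_runnerSet_iff]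

lemma add_mem_runnerSet {s : ℤ} (hs : s ∈ runnerSet v) : s + t ∈ runnerSet v := by
  obtain ⟨⟨k, r⟩, rfl⟩ := (Int.divModEquiv t).symm.surjective s
  rw [Int.divModEquiv_symm_apply] at hs ⊢
  rw [mul_add_mem_runnerSet_iff] at hs
  rw [add_right_comm, ← add_one_mul, mul_add_mem_runnerSet_iff]
  exact hs.trans (lt_add_one k).le

lemma Ici_subset_runnerSet {b : ℤ} (hb : ∀ r, v r ≤ b) : Set.Ici (b * t) ⊆ runnerSet v :=
  fun _ hs => (hb _).trans ((Int.le_ediv_iff_mul_le (by exact_mod_cast NeZero.pos t)).mpr hs)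

lemma runnerSet_subset_Ici {b : ℤ} (hb : ∀ r, b ≤ v r) : runnerSet v ⊆ Set.Ici (b * t) :=
  fun _ hs => (Int.le_ediv_iff_mul_le (by exact_mod_cast NeZero.pos t)).mp ((hb _).trans hs)

lemma exists_range_bead_eq_runnerSet (μ : YoungDiagram)
    (h : ∀ s ∈ Set.range (bead μ), s + t ∈ Set.range (bead μ)) :
    ∃ v : Fin t → ℤ, Set.range (bead μ) = runnerSet v := by
  have ht : (0 : ℤ) < t := by exact_mod_cast NeZero.pos t
  have hleast : ∀ r : Fin t, ∃ k : ℤ, k * t + r ∈ Set.range (bead μ) ∧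
      ∀ l : ℤ, l * t + r ∈ Set.range (bead μ) → k ≤ l := by
    intro r
    refine Int.exists_least_of_bdd ⟨bead μ 0 / t, ?_⟩
      ⟨μ.colLen 0, μ.colLen 0 * t + r, ?_⟩
    · rintro l ⟨i, hi⟩
      have hi0 : bead μ 0 ≤ l * t + r := hi ▸ (strictMono_bead μ).monotone (Nat.zero_le i)
      have : (r : ℤ) < t := by exact_mod_cast r.2
      exact Int.lt_add_one_iff.mp ((Int.ediv_lt_iff_lt_mul ht).mpr (by rw [add_one_mul]; omega))
    · rw [bead_eq_self μ (le_add_right (Nat.le_mul_of_pos_right _ (NeZero.pos t)))]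
      push_cast
      rfl
  choose v hv hmin using hleast
  have hup : ∀ (r : Fin t) (m : ℕ), (v r + m) * t + r ∈ Set.range (bead μ) := by
    intro r m
    induction m with
    | zero => simpa using hv r
    | succ m ih =>
      convert! h _ ih using 1
      push_cast
      ring
  refine ⟨v, Set.ext fun s => ?_⟩
  obtain ⟨⟨k, r⟩, rfl⟩ := (Int.divModEquiv t).symm.surjective s
  rw [Int.divModEquiv_symm_apply, mul_add_mem_runnerSet_iff]
  refine ⟨hmin r k, fun hk => ?_⟩
  have := hup r (k - v r).toNat
  rwa [Int.toNat_of_nonneg (sub_nonneg.mpr hk), add_sub_cancel] at this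

lemma sum_range_eq_sum_runners {M : Type*} [AddCommMonoid M] {f : ℕ → ℤ} (hf : StrictMono f)
    (hv : Set.range f = runnerSet v) {m : ℕ} {T : ℤ} (hm : f m = T * t) (g : ℤ → M) :
    ∑ i ∈ Finset.range m, g (f i) = ∑ r, ∑ k ∈ Finset.Ico (v r) T, g (k * t + r) := by
  have ht : (0 : ℤ) < t := by exact_mod_cast NeZero.pos t
  have hlt : ∀ i, (Int.divModEquiv t (f i)).1 < T ↔ i < m := fun i => by
    rw [← hf.lt_iff_lt, hm]
    exact Int.ediv_lt_iff_lt_mul ht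
  rw [Finset.sum_sigma']
  refine Finset.sum_nbij (fun i => ⟨(Int.divModEquiv t (f i)).2, (Int.divModEquiv t (f i)).1⟩)
    (fun i hi => ?_) (fun i _ j _ hij => ?_) (fun ⟨r, k⟩ hk => ?_) (fun i _ => ?_)
  · have hmem : f i ∈ runnerSet v := hv ▸ Set.mem_range_self i
    exact Finset.mem_sigma.mpr ⟨Finset.mem_univ _,
      Finset.mem_Ico.mpr ⟨hmem, (hlt i).mpr (Finset.mem_range.mp hi)⟩⟩
  · simp only [Sigma.mk.injEq, heq_eq_eq] at hij
    exact hf.injective ((Int.divModEquiv t).injective (Prod.ext hij.2 hij.1))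
  · obtain ⟨hvk, hkT⟩ := Finset.mem_Ico.mp (Finset.mem_sigma.mp hk).2
    obtain ⟨i, hi⟩ : k * t + (r : ℤ) ∈ Set.range f := hv ▸ mul_add_mem_runnerSet_iff.mpr hvk
    have hdm : Int.divModEquiv t (f i) = (k, r) := by
      rw [hi, ← Int.divModEquiv_symm_apply t (k, r), Equiv.apply_symm_apply]
    exact ⟨i, Finset.mem_coe.mpr (Finset.mem_range.mpr ((hlt i).mp (by rw [hdm]; exact hkT))),
      by simp only [hdm]⟩
  · exact congrArg g ((Int.divModEquiv t).symm_apply_apply (f i)).symm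

lemma index_add_sum_eq {f : ℕ → ℤ} (hf : StrictMono f) (hv : Set.range f = runnerSet v) {m : ℕ}
    {T : ℤ} (hT : ∀ r, v r ≤ T) (hm : f m = T * t) : m + ∑ r, v r = f m := by
  have h := sum_range_eq_sum_runners hf hv hm fun _ => (1 : ℤ)
  simp only [Finset.sum_const, Finset.card_range, Int.card_Ico, nsmul_eq_mul, mul_one,
    fun r => Int.toNat_of_nonneg (sub_nonneg.mpr (hT r)), Finset.sum_sub_distrib,
    Finset.card_univ, Fintype.card_fin] at h
  linarith

lemma exists_range_bead_eq (hv : ∑ r, v r = 0) :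
    ∃ μ : YoungDiagram, Set.range (bead μ) = runnerSet v := by
  obtain ⟨b, hb⟩ := (Set.finite_range v).bddAbove
  obtain ⟨c, hc⟩ := (Set.finite_range v).bddBelow
  have hvb : ∀ r, v r ≤ b := fun r => hb ⟨r, rfl⟩
  have hIci := Ici_subset_runnerSet hvb
  obtain ⟨f, hf, hrange⟩ := exists_strictMono_range_eq
    (bddBelow_Ici.mono (runnerSet_subset_Ici fun r => hc ⟨r, rfl⟩))
    (fun h => not_bddAbove_Ici _ (h.mono hIci))
  rw [← hrange] at hIci
  obtain ⟨m, hm⟩ := hIci Set.self_mem_Ici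
  have hfm : f m = m := by
    rw [← index_add_sum_eq hf hrange hvb hm, hv, add_zero]
  obtain ⟨μ, hμ⟩ := exists_bead_eq hf (N := m) fun i hi => by
    obtain ⟨j, rfl⟩ := Nat.exists_eq_add_of_le hi
    rw [eq_add_of_strictMono_of_Ici_subset_range hf (hm ▸ hIci), hfm, Nat.cast_add]
  exact ⟨μ, hμ ▸ hrange⟩

/-- The size of the `t`-core whose bead set is `runnerSet v`. -/
def runnerWeight {t : ℕ} (v : Fin t → ℤ) : ℤ := ∑ r, (t * tri (v r) + r * v r)

lemma sum_Ico_mul_add (t r : ℤ) {c T : ℤ} (h : c ≤ T) :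
    ∑ k ∈ Finset.Ico c T, (k * t + r) = t * tri T + r * T - (t * tri c + r * c) := by
  induction T, h using Int.leInduction with
  | base => simp
  | succ T hT ih =>
    rw [← Finset.insert_Ico_right_eq_Ico_add_one hT, Finset.sum_insert (by simp), ih, tri_add,
      show tri 1 = 0 from rfl]
    ring

lemma sum_range_eq_sub_runnerWeight {f : ℕ → ℤ} (hf : StrictMono f)
    (hv : Set.range f = runnerSet v) {m : ℕ} {T : ℤ} (hT : ∀ r, v r ≤ T) (hm : f m = T * t) :
    ∑ i ∈ Finset.range m, f i = runnerWeight (fun _ : Fin t => T) - runnerWeight v := by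
  rw [sum_range_eq_sum_runners hf hv hm fun s => s, runnerWeight, runnerWeight,
    ← Finset.sum_sub_distrib]
  exact Finset.sum_congr rfl fun r _ => sum_Ico_mul_add t r (hT r)

lemma range_natCast_eq_runnerSet_zero :
    Set.range (Nat.cast : ℕ → ℤ) = runnerSet (0 : Fin t → ℤ) := by
  have ht : (0 : ℤ) < t := by exact_mod_cast NeZero.pos t
  ext s
  refine Iff.trans ⟨?_, fun h => ⟨s.toNat, Int.toNat_of_nonneg h⟩⟩
    (Int.ediv_nonneg_iff_of_pos ht).symm
  rintro ⟨n, rfl⟩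
  exact Int.natCast_nonneg n

lemma le_of_range_bead_eq {μ : YoungDiagram} (hv : Set.range (bead μ) = runnerSet v) {T : ℕ}
    (hT : μ.colLen 0 ≤ T) (r : Fin t) : v r ≤ T := by
  have hle : μ.colLen 0 ≤ T * t + r :=
    hT.trans (le_add_right (Nat.le_mul_of_pos_right T (NeZero.pos t)))
  rw [← mul_add_mem_runnerSet_iff, ← hv]
  exact ⟨T * t + r, by rw [bead_eq_self μ hle]; push_cast; rfl⟩

lemma bead_colLen_mul (μ : YoungDiagram) (t : ℕ) [NeZero t] :
    bead μ (μ.colLen 0 * t) = μ.colLen 0 * t := by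
  rw [bead_eq_self μ (Nat.le_mul_of_pos_right _ (NeZero.pos t)), Nat.cast_mul]

lemma sum_eq_zero_of_range_bead_eq {μ : YoungDiagram} (hv : Set.range (bead μ) = runnerSet v) :
    ∑ r, v r = 0 := by
  have h := index_add_sum_eq (strictMono_bead μ) hv (le_of_range_bead_eq hv le_rfl)
    (bead_colLen_mul μ t)
  rwa [bead_colLen_mul, Nat.cast_mul, add_eq_left] at h

lemma card_eq_runnerWeight {μ : YoungDiagram} (hv : Set.range (bead μ) = runnerSet v) :
    (μ.card : ℤ) = runnerWeight v := by
  have hbeads := sum_range_eq_sub_runnerWeight (strictMono_bead μ) hv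
    (le_of_range_bead_eq hv le_rfl) (bead_colLen_mul μ t)
  have hvacuum := sum_range_eq_sub_runnerWeight Nat.strictMono_cast
    (range_natCast_eq_runnerSet_zero (t := t)) (T := μ.colLen 0)
    (fun _ => Int.natCast_nonneg _) (Nat.cast_mul (μ.colLen 0) t)
  have hzero : runnerWeight (0 : Fin t → ℤ) = 0 := by simp [runnerWeight, tri]
  rw [card_eq_sum_rowLen μ (Nat.le_mul_of_pos_right _ (NeZero.pos t)), Nat.cast_sum]
  simp only [bead, Finset.sum_sub_distrib] at hbeads
  linarith

end Abacus

section CoreCount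

lemma sum_rowLens (μ : YoungDiagram) : μ.rowLens.sum = μ.card := by
  rw [card_eq_sum_rowLen μ le_rfl, YoungDiagram.rowLens, Finset.sum_range, ← List.sum_ofFn]
  congr 1
  exact List.ext_get (by simp) (by simp)

lemma rowLens_partitionDiagram {n : ℕ} (p : n.Partition) :
    (partitionDiagram p).rowLens = p.parts.sort (· ≥ ·) :=
  YoungDiagram.rowLens_ofRowLens_eq_self fun _ hx => p.parts_pos ((Multiset.mem_sort _).mp hx)

lemma card_partitionDiagram {n : ℕ} (p : n.Partition) : (partitionDiagram p).card = n := by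
  rw [← sum_rowLens, rowLens_partitionDiagram, ← Multiset.sum_coe, Multiset.sort_eq, p.parts_sum]

lemma partitionDiagram_injective (n : ℕ) :
    Function.Injective (partitionDiagram : n.Partition → YoungDiagram) := by
  intro p p' h
  refine Nat.Partition.ext ?_
  rw [← Multiset.sort_eq p.parts (· ≥ ·), ← Multiset.sort_eq p'.parts (· ≥ ·),
    ← rowLens_partitionDiagram, ← rowLens_partitionDiagram, h]

lemma exists_partitionDiagram_eq (μ : YoungDiagram) :
    ∃ p : μ.card.Partition, partitionDiagram p = μ := by
  refine ⟨⟨μ.rowLens, fun hi => μ.pos_of_mem_rowLens _ (Multiset.mem_coe.mp hi), ?_⟩, ?_⟩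
  · rw [Multiset.sum_coe, sum_rowLens]
  · refine YoungDiagram.equivListRowLens.injective (Subtype.ext ?_)
    change (partitionDiagram _).rowLens = μ.rowLens
    rw [rowLens_partitionDiagram]
    exact (Multiset.coe_sort _ _).trans (List.mergeSort_of_pairwise (by
      simpa using μ.rowLens_sorted.pairwise))

variable {t : ℕ} [NeZero t]

/-- The Young diagram of the `t`-core with bead set `runnerSet v`. -/
noncomputable def coreDiagram (v : {v : Fin t → ℤ // ∑ r, v r = 0}) : YoungDiagram :=
  (exists_range_bead_eq v.2).choose

lemma range_bead_coreDiagram (v : {v : Fin t → ℤ // ∑ r, v r = 0}) :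
    Set.range (bead (coreDiagram v)) = runnerSet v.1 :=
  (exists_range_bead_eq v.2).choose_spec

lemma coreDiagram_injective :
    Function.Injective (coreDiagram : {v : Fin t → ℤ // ∑ r, v r = 0} → YoungDiagram) :=
  fun v w h => Subtype.ext (runnerSet_injective (by
    rw [← range_bead_coreDiagram, ← range_bead_coreDiagram, h]))

lemma card_coreDiagram (v : {v : Fin t → ℤ // ∑ r, v r = 0}) :
    ((coreDiagram v).card : ℤ) = runnerWeight v.1 :=
  card_eq_runnerWeight (range_bead_coreDiagram v)

lemma mem_range_coreDiagram_iff (μ : YoungDiagram) :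
    μ ∈ Set.range (coreDiagram : {v : Fin t → ℤ // ∑ r, v r = 0} → YoungDiagram) ↔
      ∀ c ∈ μ.cells, ¬ (t : ℤ) ∣ hookNumber μ c.1 c.2 := by
  rw [forall_not_dvd_hookNumber_iff μ t]
  constructor
  · rintro ⟨v, rfl⟩ s hs
    rw [range_bead_coreDiagram] at hs ⊢
    exact add_mem_runnerSet hs
  · intro h
    obtain ⟨v, hv⟩ := exists_range_bead_eq_runnerSet μ h
    exact ⟨⟨v, sum_eq_zero_of_range_bead_eq hv⟩,
      eq_of_range_bead_eq (by rw [range_bead_coreDiagram, hv])⟩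

lemma range_partitionDiagram_isCore (n : ℕ) :
    Set.range (fun p : {p : n.Partition // IsCorePartition t p} => partitionDiagram p.1) =
      Set.range fun v : {v : {v : Fin t → ℤ // ∑ r, v r = 0} // (coreDiagram v).card = n} =>
        coreDiagram v.1 := by
  ext μ
  constructor
  · rintro ⟨⟨p, hp⟩, rfl⟩
    obtain ⟨v, hv⟩ := (mem_range_coreDiagram_iff _).mpr hp
    exact ⟨⟨v, by rw [hv, card_partitionDiagram]⟩, hv⟩
  · rintro ⟨⟨v, rfl⟩, rfl⟩
    obtain ⟨p, hp⟩ := exists_partitionDiagram_eq (coreDiagram v)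
    refine ⟨⟨p, ?_⟩, hp⟩
    rw [IsCorePartition, hp]
    exact (mem_range_coreDiagram_iff _).mp ⟨v, rfl⟩

/-- Partitions of `n` that are `t`-cores are parametrized by the vectors of sum zero. -/
noncomputable def coreEquiv (t n : ℕ) [NeZero t] : {p : n.Partition // IsCorePartition t p} ≃
    {v : {v : Fin t → ℤ // ∑ r, v r = 0} // (coreDiagram v).card = n} :=
  (Equiv.ofInjective _ ((partitionDiagram_injective n).comp Subtype.val_injective)).trans
    ((Equiv.setCongr (range_partitionDiagram_isCore n)).trans
      (Equiv.ofInjective _ (coreDiagram_injective.comp Subtype.val_injective)).symm)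

lemma hasSum_card_fiber_mul_pow {α : Type*} (w : α → ℕ) [∀ n, Finite {x // w x = n}] {q S : ℂ}
    (hs : HasSum (fun x => q ^ w x) S) :
    HasSum (fun n => (Nat.card {x // w x = n} : ℂ) * q ^ n) S := by
  refine ((Equiv.sigmaFiberEquiv w).hasSum_iff.mpr hs).sigma fun n => ?_
  have := Fintype.ofFinite {x // w x = n}
  have h := hasSum_fintype fun _ : {x // w x = n} => q ^ n
  rw [Finset.sum_const, Finset.card_univ, nsmul_eq_mul, ← Nat.card_eq_fintype_card] at h
  exact h.congr_fun fun ⟨x, hx⟩ => congrArg (q ^ ·) hx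

lemma hasSum_coreCount_of_hasSum_runnerWeight {q S : ℂ}
    (hs : HasSum (fun v : {v : Fin t → ℤ // ∑ r, v r = 0} => q ^ runnerWeight v.1) S) :
    HasSum (fun n : ℕ => (coreCount t n : ℂ) * q ^ n) S := by
  have : ∀ n, Finite {v : {v : Fin t → ℤ // ∑ r, v r = 0} // (coreDiagram v).card = n} :=
    fun n => .of_equiv _ (coreEquiv t n)
  simp only [coreCount, fun n => Nat.card_congr (coreEquiv t n)]
  refine hasSum_card_fiber_mul_pow (fun v => (coreDiagram v).card) (hs.congr_fun fun v => ?_)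
  rw [← card_coreDiagram, zpow_natCast]

end CoreCount

section CoreGeneratingFunction

variable {q : ℂ}

lemma hasSum_prod_pi {κ : Type*} {n : ℕ} {f : Fin n → κ → ℂ} {S : Fin n → ℂ}
    (h : ∀ i, HasSum (f i) (S i)) :
    HasSum (fun v : Fin n → κ => ∏ i, f i (v i)) (∏ i, S i) := by
  induction n with
  | zero => simpa only [Fin.prod_univ_zero] using hasSum_unique fun _ : Fin 0 → κ => (1 : ℂ)
  | succ n ih =>
    rw [Fin.prod_univ_succ, ← (Fin.consEquiv fun _ => κ).hasSum_iff]
    refine (hasSum_prod_mul (h 0) (ih fun i => h i.succ)).congr_fun fun p => ?_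
    simp only [Function.comp_apply, Fin.consEquiv_apply, Fin.prod_univ_succ, Fin.cons_zero,
      Fin.cons_succ]

lemma zpow_sum {ι G₀ : Type*} [CommGroupWithZero G₀] {a : G₀} (ha : a ≠ 0) (s : Finset ι)
    (f : ι → ℤ) : a ^ ∑ i ∈ s, f i = ∏ i ∈ s, a ^ f i := by
  induction s using Finset.cons_induction with
  | empty => simp only [Finset.sum_empty, Finset.prod_empty, zpow_zero]
  | cons i s hi ih => rw [Finset.sum_cons, Finset.prod_cons, zpow_add₀ ha, ih]

lemma hasSum_runnerWeight (hq0 : q ≠ 0) (hq : ‖q‖ < 1) (t : ℕ) [NeZero t] :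
    HasSum (fun v : Fin t → ℤ => q ^ runnerWeight v)
      (∏ r : Fin t, theta (q ^ t) (q ^ (r : ℕ))) := by
  refine (hasSum_prod_pi fun r : Fin t => hasSum_theta (pow_ne_zero t hq0)
    (norm_pow_lt_one hq (NeZero.ne t)) (pow_ne_zero r hq0)).congr_fun fun v => ?_
  rw [runnerWeight, zpow_sum hq0]
  refine Finset.prod_congr rfl fun r _ => ?_
  rw [zpow_add₀ hq0, zpow_mul, zpow_mul, zpow_natCast, zpow_natCast]

/-- Translation of all beads by one step: `runnerSet (beadShift m v)` is `runnerSet v` shifted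
by `1`. It changes the sum of `v` by `1`, so that its powers sort the vectors by their sum. -/
def beadShift (m : ℕ) : Equiv.Perm (Fin (m + 1) → ℤ) where
  toFun v := Fin.cons (v (Fin.last m) + 1) (Fin.init v)
  invFun v := Fin.snoc (Fin.tail v) (v 0 - 1)
  left_inv v := by simp
  right_inv v := by simp

lemma sum_beadShift {m : ℕ} (v : Fin (m + 1) → ℤ) : ∑ r, beadShift m v r = ∑ r, v r + 1 := by
  rw [Fin.sum_univ_succ, Fin.sum_univ_castSucc]
  simp only [beadShift, Equiv.coe_fn_mk, Fin.cons_zero, Fin.cons_succ, Fin.init]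
  ring

lemma runnerWeight_beadShift {m : ℕ} (v : Fin (m + 1) → ℤ) :
    runnerWeight (beadShift m v) = runnerWeight v + ∑ r, v r := by
  rw [runnerWeight, runnerWeight, Fin.sum_univ_succ, Fin.sum_univ_castSucc (n := m),
    Fin.sum_univ_castSucc (n := m)]
  simp only [beadShift, Equiv.coe_fn_mk, Fin.cons_zero, Fin.cons_succ, Fin.init, tri_add,
    show tri 1 = 0 from rfl, Fin.val_zero, Fin.val_succ, Fin.val_castSucc, Fin.val_last,
    Nat.cast_add, Nat.cast_one, Nat.cast_zero, add_mul, one_mul, Finset.sum_add_distrib]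
  ring

lemma sum_beadShift_zpow {m : ℕ} (v : Fin (m + 1) → ℤ) (k : ℤ) :
    ∑ r, (beadShift m ^ k) v r = ∑ r, v r + k := by
  have hstep : ∀ k : ℤ, ∑ r, (beadShift m ^ (k + 1)) v r = ∑ r, (beadShift m ^ k) v r + 1 :=
    fun k => by rw [add_comm k, zpow_one_add, Equiv.Perm.mul_apply, sum_beadShift]
  induction k with
  | zero => simp
  | succ k ih => rw [hstep, ih, add_assoc]
  | pred k ih =>
    have := hstep (-k - 1)
    rw [sub_add_cancel] at this
    omega

lemma runnerWeight_beadShift_zpow {m : ℕ} (v : Fin (m + 1) → ℤ) (k : ℤ) :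
    runnerWeight ((beadShift m ^ k) v) = runnerWeight v + k * ∑ r, v r + tri k := by
  have hstep : ∀ k : ℤ, runnerWeight ((beadShift m ^ (k + 1)) v) =
      runnerWeight ((beadShift m ^ k) v) + (∑ r, v r + k) := fun k => by
    rw [add_comm k, zpow_one_add, Equiv.Perm.mul_apply, runnerWeight_beadShift,
      sum_beadShift_zpow]
  have htri : ∀ k : ℤ, tri (k + 1) = tri k + k := fun k => by
    rw [tri_add, show tri 1 = 0 from rfl, add_zero, mul_one]
  induction k with
  | zero => simp [tri]
  | succ k ih =>
    rw [hstep, ih, htri]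
    ring
  | pred k ih =>
    have h := hstep (-k - 1)
    have h' := htri (-k - 1)
    rw [sub_add_cancel] at h h'
    linarith

/-- Vectors are translates of vectors of sum zero, the translation being given by their sum. -/
def beadShiftEquiv (m : ℕ) :
    ℤ × {v : Fin (m + 1) → ℤ // ∑ r, v r = 0} ≃ (Fin (m + 1) → ℤ) where
  toFun p := (beadShift m ^ p.1) p.2.1
  invFun v := (∑ r, v r, ⟨(beadShift m ^ (-∑ r, v r)) v, by
    rw [sum_beadShift_zpow, add_neg_cancel]⟩)
  left_inv := by
    rintro ⟨k, v, hv⟩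
    have hk : ∑ r, (beadShift m ^ k) v r = k := by rw [sum_beadShift_zpow, hv, zero_add]
    refine Prod.ext hk (Subtype.ext ?_)
    simp only [hk, ← Equiv.Perm.mul_apply, ← zpow_add, neg_add_cancel, zpow_zero,
      Equiv.Perm.one_apply]
  right_inv v := by
    simp only [← Equiv.Perm.mul_apply, ← zpow_add, add_neg_cancel, zpow_zero,
      Equiv.Perm.one_apply]

-- Sorting all vectors by their sum splits the series over `Fin t → ℤ` into `theta q 1` times the
-- series over the vectors of sum zero.
lemma hasSum_runnerWeight_sum_eq_zero (hq0 : q ≠ 0) (hq : ‖q‖ < 1) (t : ℕ) [NeZero t] :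
    HasSum (fun v : {v : Fin t → ℤ // ∑ r, v r = 0} => q ^ runnerWeight v.1)
      (eulerE t q ^ t / eulerE 1 q) := by
  obtain ⟨m, rfl⟩ := Nat.exists_eq_add_one_of_ne_zero (NeZero.ne t)
  have hall := hasSum_runnerWeight hq0 hq (m + 1)
  have hcores : Summable fun v : {v : Fin (m + 1) → ℤ // ∑ r, v r = 0} => q ^ runnerWeight v.1 :=
    hall.summable.comp_injective Subtype.val_injective
  have hprod : HasSum (fun v : Fin (m + 1) → ℤ => q ^ runnerWeight v) (theta q 1 *
      ∑' v : {v : Fin (m + 1) → ℤ // ∑ r, v r = 0}, q ^ runnerWeight v.1) := by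
    refine (beadShiftEquiv m).hasSum_iff.mp
      ((hasSum_prod_mul (hasSum_theta hq0 hq one_ne_zero) hcores.hasSum).congr_fun fun p => ?_)
    rw [Function.comp_apply, beadShiftEquiv, Equiv.coe_fn_mk, runnerWeight_beadShift_zpow, p.2.2,
      mul_zero, add_zero, zpow_add₀ hq0, one_zpow, mul_one, mul_comm]
  have htheta := prod_theta hq0 hq one_ne_zero (m + 1)
  simp only [mul_one] at htheta
  rw [Finset.prod_range, hall.unique hprod] at htheta
  have hE1 := eulerE_ne_zero hq 1
  have hE2 := eulerE_ne_zero hq 2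
  have hθ : theta q 1 ≠ 0 := by
    rw [theta_one hq0 hq]
    exact div_ne_zero (mul_ne_zero two_ne_zero (pow_ne_zero 2 hE2)) hE1
  convert hcores.hasSum using 1
  rw [div_eq_iff hE1]
  refine mul_left_cancel₀ hθ ?_
  rw [eulerE, eulerE, pow_one]
  linear_combination -htheta

theorem hasSum_coreCount (hq0 : q ≠ 0) (hq : ‖q‖ < 1) (t : ℕ) [NeZero t] :
    HasSum (fun n : ℕ => (coreCount t n : ℂ) * q ^ n) (eulerE t q ^ t / eulerE 1 q) :=
  hasSum_coreCount_of_hasSum_runnerWeight (hasSum_runnerWeight_sum_eq_zero hq0 hq t)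

end CoreGeneratingFunction

section LevelTen

variable {q : ℂ}

/-- The Hauptmodul `E₂ E₅⁵ / (q E₁ E₁₀⁵)` of `Γ₀(10)`. Up to a common factor, all the quotients of
Euler products in the theorem are monomials in its values at `q` and `q²`. -/
noncomputable def levelTen (q : ℂ) : ℂ :=
  eulerE 2 q * eulerE 5 q ^ 5 / (q * eulerE 1 q * eulerE 10 q ^ 5)

lemma levelTen_ne_zero (hq0 : q ≠ 0) (hq : ‖q‖ < 1) : levelTen q ≠ 0 :=
  div_ne_zero (mul_ne_zero (eulerE_ne_zero hq 2) (pow_ne_zero 5 (eulerE_ne_zero hq 5)))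
    (mul_ne_zero (mul_ne_zero hq0 (eulerE_ne_zero hq 1)) (pow_ne_zero 5 (eulerE_ne_zero hq 10)))

lemma levelTen_sq (q : ℂ) :
    levelTen (q ^ 2) = eulerE 4 q * eulerE 10 q ^ 5 / (q ^ 2 * eulerE 2 q * eulerE 20 q ^ 5) := by
  simp only [levelTen, eulerE_pow, Nat.reduceMul]

lemma levelTen_add_one (hq0 : q ≠ 0) (hq : ‖q‖ < 1) :
    levelTen q + 1 = eulerE 2 q ^ 4 * eulerE 5 q ^ 2 / (q * eulerE 1 q ^ 2 * eulerE 10 q ^ 4) := by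
  have h₁ := eulerE_ne_zero hq 1
  have h₅ := eulerE_ne_zero hq 5
  have h₁₀ := eulerE_ne_zero hq 10
  have h := eulerE_psi_sq_sub hq0 hq
  rw [levelTen]
  field_simp at h ⊢
  linear_combination -h

lemma levelTen_sub_four (hq0 : q ≠ 0) (hq : ‖q‖ < 1) :
    levelTen q - 4 = eulerE 1 q ^ 3 * eulerE 5 q / (q * eulerE 2 q * eulerE 10 q ^ 3) := by
  have h₁ := eulerE_ne_zero hq 1
  have h₂ := eulerE_ne_zero hq 2
  have h₅ := eulerE_ne_zero hq 5
  have h₁₀ := eulerE_ne_zero hq 10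
  have h := eulerE_phi_sq_sub hq0 hq
  rw [levelTen]
  field_simp at h ⊢
  linear_combination -h

lemma levelTen_mul_levelTen_neg (hq0 : q ≠ 0) (hq : ‖q‖ < 1) :
    levelTen q * levelTen (-q) = -levelTen (q ^ 2) := by
  have h₁ := eulerE_ne_zero hq 1
  have h₂ := eulerE_ne_zero hq 2
  have h₄ := eulerE_ne_zero hq 4
  have h₅ := eulerE_ne_zero hq 5
  have h₁₀ := eulerE_ne_zero hq 10
  have h₂₀ := eulerE_ne_zero hq 20
  rw [levelTen_sq, levelTen, levelTen, eulerE_neg_of_even (n := 2) (by decide),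
    eulerE_neg_of_even (n := 10) (by decide), eulerE_neg_of_odd hq (n := 1) (by decide),
    eulerE_neg_of_odd hq (n := 5) (by decide)]
  simp only [Nat.reduceMul]
  field_simp

lemma levelTen_add_one_mul_levelTen_neg_add_one (hq0 : q ≠ 0) (hq : ‖q‖ < 1) :
    (levelTen q + 1) * (levelTen (-q) + 1) * levelTen (q ^ 2) =
      -((levelTen (q ^ 2) + 1) * (levelTen (q ^ 2) - 4)) := by
  have h₁ := eulerE_ne_zero hq 1
  have h₂ := eulerE_ne_zero hq 2
  have h₄ := eulerE_ne_zero hq 4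
  have h₅ := eulerE_ne_zero hq 5
  have h₁₀ := eulerE_ne_zero hq 10
  have h₂₀ := eulerE_ne_zero hq 20
  have hq₂ : ‖q ^ 2‖ < 1 := norm_pow_lt_one hq two_ne_zero
  rw [levelTen_add_one hq0 hq, levelTen_add_one (neg_ne_zero.mpr hq0) (by rwa [norm_neg]),
    levelTen_add_one (pow_ne_zero 2 hq0) hq₂, levelTen_sub_four (pow_ne_zero 2 hq0) hq₂,
    levelTen_sq, eulerE_neg_of_even (n := 2) (by decide), eulerE_neg_of_even (n := 10) (by decide),
    eulerE_neg_of_odd hq (n := 1) (by decide), eulerE_neg_of_odd hq (n := 5) (by decide)]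
  simp only [eulerE_pow, Nat.reduceMul]
  field_simp

-- Eliminate `levelTen (-q)` from the two relations between the values at `q`, `-q` and `q ^ 2`.
lemma levelTen_modular_equation (hq0 : q ≠ 0) (hq : ‖q‖ < 1) :
    levelTen (q ^ 2) ^ 2 + 2 * levelTen q * levelTen (q ^ 2) - levelTen q ^ 2 * levelTen (q ^ 2) +
      4 * levelTen q = 0 := by
  have hneg := levelTen_mul_levelTen_neg hq0 hq
  have h := levelTen_add_one_mul_levelTen_neg_add_one hq0 hq
  linear_combination -levelTen q * h + (levelTen q + 1) * levelTen (q ^ 2) * hneg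

/-- The sixteen-term sum of the theorem divided by its first term, in the variables
`x = levelTen q` and `y = levelTen (q ^ 2)`. -/
def reducedSum {K : Type*} [Field K] (x y : K) : K :=
  1 - 3 * x ^ 3 / y ^ 2 + 4 * x / y - 12 * x ^ 2 / y ^ 2 - 20 * x ^ 4 / y ^ 3 + 24 / y -
    27 * x ^ 5 / y ^ 4 - 60 * x ^ 3 / y ^ 3 + 196 * x / y ^ 2 - 83 * x ^ 4 / y ^ 4 +
    456 * x ^ 2 / y ^ 3 + 296 * x ^ 3 / y ^ 4 + 96 * x / y ^ 3 + 128 * x ^ 4 / y ^ 5 +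
    592 * x ^ 2 / y ^ 4 + 512 * x ^ 3 / y ^ 5

lemma reducedSum_eq {K : Type*} [Field K] {x y : K} (hy : y ≠ 0)
    (h : y ^ 2 + 2 * x * y - x ^ 2 * y + 4 * x = 0) :
    y ^ 4 * reducedSum x y = x ^ 2 * (x - 4) ^ 2 * (x + 1) * (1 + 2 * y + x * y) := by
  rw [reducedSum]
  field_simp
  linear_combination (y ^ 3 + x ^ 2 * y ^ 2 + 2 * x * y ^ 2 + 24 * y ^ 2 + x ^ 4 * y -
    3 * x ^ 3 * y + 8 * x ^ 2 * y + 144 * x * y + 32 * x ^ 3 + 128 * x ^ 2) * h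

lemma sixteen_eta_quotients_eq {K : Type*} [Field K] {q a b c d e g x y : K} (ha : a ≠ 0)
    (hb : b ≠ 0) (hc : c ≠ 0) (hd : d ≠ 0) (he : e ≠ 0) (hg : g ≠ 0)
    (hx : x = b * d ^ 5 / (q * a * e ^ 5)) (hy : y = c * e ^ 5 / (q ^ 2 * b * g ^ 5)) :
    (c ^ 4 * e ^ 40) / (a ^ 2 * b ^ 8 * d ^ 15 * g ^ 16)
        - q * (3 * ((c ^ 2 * e ^ 15) / (a ^ 5 * b ^ 3 * g ^ 6))
            - 4 * ((c ^ 3 * e ^ 30) / (a ^ 3 * b ^ 6 * d ^ 10 * g ^ 11)))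
        - q ^ 2 * (12 * ((c ^ 2 * e ^ 20) / (a ^ 4 * b ^ 4 * d ^ 5 * g ^ 6))
            + 20 * ((c * d ^ 5 * e ^ 5) / (a ^ 6 * b * g))
            - 24 * ((c ^ 3 * e ^ 35) / (a ^ 2 * b ^ 7 * d ^ 15 * g ^ 11)))
        - q ^ 3 * (27 * ((b * d ^ 10 * g ^ 4) / (a ^ 7 * e ^ 5))
            + 60 * ((c * e ^ 10) / (a ^ 5 * b ^ 2 * g))
            - 196 * ((c ^ 2 * e ^ 25) / (a ^ 3 * b ^ 5 * d ^ 10 * g ^ 6)))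
        - q ^ 4 * (83 * ((d ^ 5 * g ^ 4) / a ^ 6)
            - 456 * ((c * e ^ 15) / (a ^ 4 * b ^ 3 * d ^ 5 * g)))
        + q ^ 5 * (296 * ((e ^ 5 * g ^ 4) / (a ^ 5 * b))
            + 96 * ((c * e ^ 20) / (a ^ 3 * b ^ 4 * d ^ 10 * g)))
        + q ^ 6 * (128 * ((b * d ^ 5 * g ^ 9) / (a ^ 6 * c * e ^ 5))
            + 592 * ((e ^ 10 * g ^ 4) / (a ^ 4 * b ^ 2 * d ^ 5)))
        + 512 * q ^ 7 * (g ^ 9 / (a ^ 5 * c)) =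
      c ^ 4 * e ^ 40 / (a ^ 2 * b ^ 8 * d ^ 15 * g ^ 16) * reducedSum x y := by
  rw [reducedSum, hx, hy]
  field_simp
  ring

lemma three_eta_quotients_eq (hq0 : q ≠ 0) (hq : ‖q‖ < 1) :
    eulerE 4 q * eulerE 5 q ^ 4 / (eulerE 1 q * eulerE 20 q) +
        q ^ 3 * (eulerE 20 q ^ 4 / eulerE 5 q) +
        2 * q * (eulerE 4 q * eulerE 10 q ^ 5 / (eulerE 2 q * eulerE 5 q * eulerE 20 q)) =
      eulerE 4 q ^ 4 * eulerE 10 q ^ 40 /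
          (eulerE 1 q ^ 2 * eulerE 2 q ^ 8 * eulerE 5 q ^ 15 * eulerE 20 q ^ 16) *
        reducedSum (levelTen q) (levelTen (q ^ 2)) := by
  have h₁ := eulerE_ne_zero hq 1
  have h₂ := eulerE_ne_zero hq 2
  have h₄ := eulerE_ne_zero hq 4
  have h₅ := eulerE_ne_zero hq 5
  have h₁₀ := eulerE_ne_zero hq 10
  have h₂₀ := eulerE_ne_zero hq 20
  have hy := levelTen_ne_zero (pow_ne_zero 2 hq0) (norm_pow_lt_one hq two_ne_zero)
  refine mul_left_cancel₀ (pow_ne_zero 4 hy) ?_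
  rw [mul_left_comm, reducedSum_eq hy (levelTen_modular_equation hq0 hq), levelTen_sub_four hq0 hq,
    levelTen_add_one hq0 hq, levelTen_sq, levelTen]
  field_simp
  ring

end LevelTen

section Extraction

lemma sum_primitiveRoot_pow_pow {K : Type*} [Field K] {ζ : K} {m : ℕ} (hζ : IsPrimitiveRoot ζ m)
    (n : ℕ) : ∑ j ∈ Finset.range m, (ζ ^ j) ^ n = if m ∣ n then (m : K) else 0 := by
  simp only [fun j => pow_right_comm ζ j n]
  split_ifs with h
  · simp only [(hζ.pow_eq_one_iff_dvd n).mpr h, one_pow, Finset.sum_const, Finset.card_range,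
      nsmul_one]
  · have hne : ζ ^ n ≠ 1 := fun h' => h ((hζ.pow_eq_one_iff_dvd n).mp h')
    rw [geom_sum_eq hne, pow_right_comm, hζ.pow_eq_one, one_pow, sub_self, zero_div]

lemma sum_primitiveRoot_mul_pow {K : Type*} [Field K] {ζ : K} {m : ℕ} (hζ : IsPrimitiveRoot ζ m)
    (b w : K) (n : ℕ) : ∑ j ∈ Finset.range m, b * (ζ ^ j * w) ^ n =
      if m ∣ n then m * (b * w ^ n) else 0 := by
  simp only [mul_pow]
  rw [← Finset.mul_sum, ← Finset.sum_mul, sum_primitiveRoot_pow_pow hζ, ite_mul, mul_ite,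
    zero_mul, mul_zero]
  congr 1
  ring

-- Averaging over the `m`-th roots of `q` annihilates the exponents that are not multiples of `m`.
lemma hasSum_mul_index {m : ℕ} [NeZero m] {a c : ℕ → ℂ} {q : ℂ}
    (h : ∀ w : ℂ, w ^ m = q → HasSum (fun n => a n * w ^ n) (∑ k ∈ Finset.range m, c k * w ^ k)) :
    HasSum (fun n => a (m * n) * q ^ n) (c 0) := by
  have hm : m ≠ 0 := NeZero.ne m
  obtain ⟨w, hw⟩ := IsAlgClosed.exists_pow_nat_eq q (NeZero.pos m)
  obtain ⟨ζ, hζ⟩ : ∃ ζ : ℂ, IsPrimitiveRoot ζ m := ⟨_, Complex.isPrimitiveRoot_exp m hm⟩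
  have hsum : HasSum (fun n => ∑ j ∈ Finset.range m, a n * (ζ ^ j * w) ^ n)
      (∑ j ∈ Finset.range m, ∑ k ∈ Finset.range m, c k * (ζ ^ j * w) ^ k) :=
    hasSum_sum fun j _ => h _ (by
      rw [mul_pow, pow_right_comm, hζ.pow_eq_one, one_pow, one_mul, hw])
  rw [Finset.sum_comm] at hsum
  simp only [sum_primitiveRoot_mul_pow hζ] at hsum
  have hconst : (∑ k ∈ Finset.range m, if m ∣ k then (m : ℂ) * (c k * w ^ k) else 0) =
      m * c 0 := by
    rw [Finset.sum_eq_single_of_mem 0 (Finset.mem_range.mpr (NeZero.pos m)) fun k hk hk0 =>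
      if_neg (Nat.not_dvd_of_pos_of_lt (Nat.pos_of_ne_zero hk0) (Finset.mem_range.mp hk)),
      if_pos (dvd_zero m), pow_zero, mul_one]
  rw [hconst, ← (mul_right_injective₀ hm).hasSum_iff
    fun n hn => if_neg fun ⟨k, hk⟩ => hn ⟨k, hk.symm⟩] at hsum
  have hmC : (m : ℂ) ≠ 0 := Nat.cast_ne_zero.mpr hm
  refine ((hasSum_mul_left_iff hmC).mp (hsum.congr_fun fun n => ?_))
  rw [Function.comp_apply, if_pos (dvd_mul_right m n), pow_mul, hw]

variable {q : ℂ}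

lemma theta_one_dissection_five (hq0 : q ≠ 0) (hq : ‖q‖ < 1) :
    theta q 1 = 2 * theta (q ^ 25) (q ^ 10) + 2 * q * theta (q ^ 25) (q ^ 5) +
      q ^ 3 * theta (q ^ 25) 1 := by
  have h := theta_dissection hq0 hq one_ne_zero 5
  simp only [Finset.sum_range_succ, Finset.sum_range_zero, one_pow, mul_one, Nat.choose,
    Nat.reduceAdd, Nat.reduceMul, Nat.reducePow, mul_zero, zero_add, pow_zero, one_mul,
    pow_one] at h
  rw [h, theta_pow_symm hq0 (show 15 + 10 = 25 from rfl),
    theta_pow_symm hq0 (show 20 + 5 = 25 from rfl), theta_pow_symm hq0 (show 25 + 0 = 25 from rfl),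
    pow_zero, theta_pow_eq_mul hq0 (show 25 + 5 = 30 from rfl)]
  ring

lemma hasSum_coreCount_four (hq0 : q ≠ 0) (hq : ‖q‖ < 1) :
    HasSum (fun n : ℕ => (coreCount 4 n : ℂ) * q ^ n)
      (theta q 1 / 2 * (theta (q ^ 2) 1 / 2) ^ 2) := by
  have h₁ := eulerE_ne_zero hq 1
  have h₂ := eulerE_ne_zero hq 2
  convert hasSum_coreCount hq0 hq 4 using 1
  rw [theta_one hq0 hq, theta_one (pow_ne_zero 2 hq0) (norm_pow_lt_one hq two_ne_zero)]
  simp only [eulerE_pow, Nat.reduceMul]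
  field_simp

lemma hasSum_coreCount_four_mul_five_theta (hq0 : q ≠ 0) (hq : ‖q‖ < 1) :
    HasSum (fun n : ℕ => (coreCount 4 (5 * n) : ℂ) * q ^ n)
      (theta (q ^ 5) (q ^ 2) * theta (q ^ 10) (q ^ 4) ^ 2 +
        q * (theta (q ^ 5) q * theta (q ^ 10) (q ^ 2) ^ 2) +
        q ^ 3 * (theta (q ^ 5) 1 / 2 * (theta (q ^ 10) 1 / 2) ^ 2) +
        2 * q * (theta (q ^ 5) 1 / 2 * (theta (q ^ 10) (q ^ 2) * theta (q ^ 10) (q ^ 4)))) := by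
  obtain ⟨A, hA⟩ : ∃ A, A = theta (q ^ 5) (q ^ 2) := ⟨_, rfl⟩
  obtain ⟨B, hB⟩ : ∃ B, B = theta (q ^ 5) q := ⟨_, rfl⟩
  obtain ⟨P, hP⟩ : ∃ P, P = theta (q ^ 5) 1 / 2 := ⟨_, rfl⟩
  obtain ⟨A', hA'⟩ : ∃ A', A' = theta (q ^ 10) (q ^ 4) := ⟨_, rfl⟩
  obtain ⟨B', hB'⟩ : ∃ B', B' = theta (q ^ 10) (q ^ 2) := ⟨_, rfl⟩
  obtain ⟨P', hP'⟩ : ∃ P', P' = theta (q ^ 10) 1 / 2 := ⟨_, rfl⟩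
  rw [← hA, ← hB, ← hP, ← hA', ← hB', ← hP']
  let c : ℕ → ℂ
    | 0 => A * A' ^ 2 + q * (B * B' ^ 2) + q ^ 3 * (P * P' ^ 2) + 2 * q * (P * (B' * A'))
    | 1 => 2 * q * A * A' * P' + B * A' ^ 2 + 2 * q ^ 2 * P * B' * P'
    | 2 => A * (q ^ 2 * P' ^ 2 + 2 * A' * B') + 2 * q * B * A' * P' + q * P * B' ^ 2
    | 3 => 2 * q * A * B' * P' + B * (q ^ 2 * P' ^ 2 + 2 * A' * B') + P * A' ^ 2
    | _ => A * B' ^ 2 + 2 * q * B * B' * P' + 2 * q * P * A' * P'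
  refine hasSum_mul_index (a := fun n => (coreCount 4 n : ℂ)) (c := c) fun w hw => ?_
  have hw0 : w ≠ 0 := by
    rintro rfl
    exact hq0 (by rw [← hw, zero_pow (NeZero.ne 5)])
  have hw1 : ‖w‖ < 1 := by
    rwa [← pow_lt_one_iff_of_nonneg (norm_nonneg w) (NeZero.ne 5), ← norm_pow, hw]
  have hψ : theta w 1 / 2 = A + w * B + w ^ 3 * P := by
    rw [theta_one_dissection_five hw0 hw1, hA, hB, hP, ← hw]
    simp only [← pow_mul, Nat.reduceMul]
    ring
  have hψ' : theta (w ^ 2) 1 / 2 = A' + w ^ 2 * B' + w ^ 6 * P' := by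
    rw [theta_one_dissection_five (pow_ne_zero 2 hw0) (norm_pow_lt_one hw1 two_ne_zero), hA', hB',
      hP', ← hw]
    simp only [← pow_mul, Nat.reduceMul]
    ring
  convert hasSum_coreCount_four hw0 hw1 using 1
  rw [hψ, hψ']
  simp only [Finset.sum_range_succ, Finset.sum_range_zero, c]
  rw [← hw]
  ring

lemma hasSum_coreCount_four_mul_five (hq0 : q ≠ 0) (hq : ‖q‖ < 1) :
    HasSum (fun n : ℕ => (coreCount 4 (5 * n) : ℂ) * q ^ n)
      (eulerE 4 q * eulerE 5 q ^ 4 / (eulerE 1 q * eulerE 20 q) +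
        q ^ 3 * (eulerE 20 q ^ 4 / eulerE 5 q) +
        2 * q * (eulerE 4 q * eulerE 10 q ^ 5 / (eulerE 2 q * eulerE 5 q * eulerE 20 q))) := by
  have h₁₀ := eulerE_ne_zero hq 10
  have h := hasSum_coreCount_four_mul_five_theta hq0 hq
  rw [theta_mul_sq_add_theta_mul_sq hq0 hq, theta_sq_mul_theta_eq_eulerE hq0 hq,
    theta_one (pow_ne_zero 5 hq0) (norm_pow_lt_one hq (NeZero.ne 5)),
    theta_one (pow_ne_zero 10 hq0) (norm_pow_lt_one hq (NeZero.ne 10))] at h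
  simp only [eulerE_pow, Nat.reduceMul] at h
  convert h using 1
  field_simp

end Extraction

section ConstantTerm

lemma eulerE_zero_right (n : ℕ) [NeZero n] : eulerE n 0 = 1 := by
  simp only [eulerE, qProduct, zero_pow (NeZero.ne n), zero_mul, sub_zero, tprod_one]

lemma coreCount_zero (t : ℕ) : coreCount t 0 = 1 := by
  have h : ∀ p : (0 : ℕ).Partition, IsCorePartition t p := by
    intro p c hc
    rw [Finset.card_eq_zero.mp (card_partitionDiagram p)] at hc
    exact absurd hc (Finset.notMem_empty c)
  rw [coreCount, Nat.card_congr (Equiv.subtypeUnivEquiv h), Nat.card_unique]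

end ConstantTerm

theorem theorem4 (q : ℂ) (hq : ‖q‖ < 1)
    (E : ℕ → ℂ) (hE : E = fun n => eulerE n q) :
    HasSum (fun n : ℕ => (coreCount 4 (5 * n) : ℂ) * q ^ n)
      ((E 4 ^ 4 * E 10 ^ 40) / (E 1 ^ 2 * E 2 ^ 8 * E 5 ^ 15 * E 20 ^ 16)
        - q * (3 * ((E 4 ^ 2 * E 10 ^ 15) / (E 1 ^ 5 * E 2 ^ 3 * E 20 ^ 6))
            - 4 * ((E 4 ^ 3 * E 10 ^ 30) / (E 1 ^ 3 * E 2 ^ 6 * E 5 ^ 10 * E 20 ^ 11)))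
        - q ^ 2 * (12 * ((E 4 ^ 2 * E 10 ^ 20) / (E 1 ^ 4 * E 2 ^ 4 * E 5 ^ 5 * E 20 ^ 6))
            + 20 * ((E 4 * E 5 ^ 5 * E 10 ^ 5) / (E 1 ^ 6 * E 2 * E 20))
            - 24 * ((E 4 ^ 3 * E 10 ^ 35) / (E 1 ^ 2 * E 2 ^ 7 * E 5 ^ 15 * E 20 ^ 11)))
        - q ^ 3 * (27 * ((E 2 * E 5 ^ 10 * E 20 ^ 4) / (E 1 ^ 7 * E 10 ^ 5))
            + 60 * ((E 4 * E 10 ^ 10) / (E 1 ^ 5 * E 2 ^ 2 * E 20))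
            - 196 * ((E 4 ^ 2 * E 10 ^ 25) / (E 1 ^ 3 * E 2 ^ 5 * E 5 ^ 10 * E 20 ^ 6)))
        - q ^ 4 * (83 * ((E 5 ^ 5 * E 20 ^ 4) / E 1 ^ 6)
            - 456 * ((E 4 * E 10 ^ 15) / (E 1 ^ 4 * E 2 ^ 3 * E 5 ^ 5 * E 20)))
        + q ^ 5 * (296 * ((E 10 ^ 5 * E 20 ^ 4) / (E 1 ^ 5 * E 2))
            + 96 * ((E 4 * E 10 ^ 20) / (E 1 ^ 3 * E 2 ^ 4 * E 5 ^ 10 * E 20)))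
        + q ^ 6 * (128 * ((E 2 * E 5 ^ 5 * E 20 ^ 9) / (E 1 ^ 6 * E 4 * E 10 ^ 5))
            + 592 * ((E 10 ^ 10 * E 20 ^ 4) / (E 1 ^ 4 * E 2 ^ 2 * E 5 ^ 5)))
        + 512 * q ^ 7 * (E 20 ^ 9 / (E 1 ^ 5 * E 4))) := by
  subst hE
  rcases eq_or_ne q 0 with rfl | hq0
  · have hsingle := hasSum_single (f := fun n : ℕ => (coreCount 4 (5 * n) : ℂ) * 0 ^ n) 0
      fun n hn => by rw [zero_pow hn, mul_zero]
    simpa [eulerE_zero_right, coreCount_zero] using hsingle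
  · have hE := eulerE_ne_zero hq
    rw [sixteen_eta_quotients_eq (x := levelTen q) (hE 1) (hE 2) (hE 4) (hE 5) (hE 10) (hE 20) rfl
      (levelTen_sq q), ← three_eta_quotients_eq hq0 hq]
    exact hasSum_coreCount_four_mul_five hq0 hq
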